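/- Let $n\ge 1$ and let $\mathbb{B}^{n+1}=\{y\in\mathbb{R}^{n+1}:|y|<1\}$ carry the hyperbolic metric $\bar g=\frac{4}{(1-|y|^2)^2}\langle\cdot,\cdot\rangle$ (Poincaré ball model of $\mathbb{H}^{n+1}$). Let $R>0$ and let $B_R$ be the open geodesic ball of hyperbolic radius $R$ about the origin, that is, the Euclidean ball $\{|y|<r_0\}$ with $r_0=\sqrt{\frac{\cosh R-1}{\cosh R+1}}$; let $\bar N$ be the outward $\bar g$-unit normal of $\partial B_R$. Let $M$ be a compact smooth $n$-dimensional manifold with (possibly empty) boundary and $x:M\to\overline{B_R}$ a smooth immersion with $x(\mathrm{int}\,M)\subset B_R$ and $x(\partial M)\subset\partial B_R$, and let $\nu$ be a smooth $\bar g$-unit normal field along $x$. Suppose that $M$ meets $\partial B_R$ at a constant contact angle $\theta\in(0,\pi)$, that is, $$\bar g(\nu,\bar N\circ x)=\cos(\pi-\theta)=-\cos\theta\quad\text{on }\partial M.$$ Give $M$ the induced metric $g=x^*\bar g$ with area element $dA$. Let $h(X,Y)=\bar g(\bar\nabla_X\nu,Y)$ be the second fundamental form, where $\bar\nabla$ is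 the Levi-Civita connection of $\bar g$, let $\kappa_1,\dots,\kappa_n$ be the principal curvatures (the eigenvalues of $h$ with respect to $g$), and let $\sigma_j$ be the $j$-th elementary symmetric polynomial of $\kappa_1,\dots,\kappa_n$, with $\sigma_0=1$. For a unit vector $a\in\mathbb{R}^{n+1}$ and $y\in\mathbb{B}^{n+1}$ put $$X_a(y)=\frac{2}{1-r_0^2}\Big[\langle y,a\rangle y-\tfrac12(|y|^2+r_0^2)a\Big],\qquad V_a(y)=\frac{2\langle y,a\rangle}{1-|y|^2},\qquad Y_a(y)=\tfrac12(1+|y|^2)a-\langle y,a\rangle y,$$ and evaluate these along $x$. Then for every integer $1\le k\le n$, $$(n-k+1)\int_M\big[\sigma_{k-1}V_a+\sinh R\cos\theta\,\sigma_{k-1}\,\bar g(Y_a,\nu)\big]\,dA=k\int_M\sigma_k\,\bar g(X_a,\nu)\,dA.$$ -/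

import Mathlib

open MeasureTheory
open scoped Manifold ContDiff

noncomputable section

namespace HypBall

/-- Euclidean space of dimension `m`; its open unit ball is the underlying set of hyperbolic space
in the Poincaré ball model. -/
abbrev Euc (m : ℕ) : Type := EuclideanSpace ℝ (Fin m)

section Ambient

variable {m : ℕ}

/-- The factor `e^u = 2 / (1 - |y|²)`. -/
def confFactor (y : Euc m) : ℝ := 2 / (1 - ‖y‖ ^ 2)

/-- The hyperbolic metric `4 / (1 - |y|²)² ⟨v, w⟩` of the Poincaré ball model. -/
def hypMetric (y v w : Euc m) : ℝ := confFactor y ^ 2 * inner ℝ v w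

/-- The Christoffel symbols of the hyperbolic metric, as a bilinear map in `v`, `w`: the Levi-Civita
connection of `hypMetric` is `∇_v W = D_v W + christoffel y v W`. The lemmas `christoffel_symm` (no
torsion) and `hasDerivAt_hypMetric` (compatibility with the metric) determine it. -/
def christoffel (y v w : Euc m) : Euc m :=
  confFactor y • ((inner ℝ y v : ℝ) • w + (inner ℝ y w : ℝ) • v - (inner ℝ v w : ℝ) • y)

theorem christoffel_symm (y v w : Euc m) : christoffel y v w = christoffel y w v := by
  unfold christoffel
  rw [real_inner_comm v w, add_comm ((inner ℝ y v : ℝ) • w)]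

theorem hasDerivAt_hypMetric (y : Euc m) (hy : ‖y‖ < 1) (z v w : Euc m) :
    HasDerivAt (fun t : ℝ => hypMetric (y + t • z) v w)
      (hypMetric y (christoffel y z v) w + hypMetric y v (christoffel y z w)) 0 := by
  have h0 : (1 : ℝ) - ‖y‖ ^ 2 ≠ 0 := by nlinarith [norm_nonneg y]
  have hl : HasDerivAt (fun t : ℝ => y + t • z) z 0 := by
    simpa using ((hasDerivAt_id (0 : ℝ)).smul_const z).const_add y
  have h1 := ((hl.norm_sq.const_sub 1).fun_inv (by simpa using h0)).const_mul 2
  have h2 := (h1.pow 2).mul_const (inner ℝ v w : ℝ)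
  refine (h2.congr_deriv ?_).congr_of_eventuallyEq ?_
  · simp only [hypMetric, christoffel, confFactor, inner_smul_left, inner_smul_right,
      inner_add_left, inner_add_right, inner_sub_left, inner_sub_right, zero_smul, add_zero,
      RCLike.conj_to_real, real_inner_comm v z, real_inner_comm v y,
      Nat.reduceSub, pow_one, Nat.cast_ofNat]
    generalize 1 - ‖y‖ ^ 2 = c at h0
    field_simp
    ring
  · exact Filter.Eventually.of_forall fun t => by simp [hypMetric, confFactor, div_eq_mul_inv]

/-- The Euclidean radius `r₀` of the geodesic ball of hyperbolic radius `R` about the origin. -/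
def euclRadius (R : ℝ) : ℝ := Real.sqrt ((Real.cosh R - 1) / (Real.cosh R + 1))

/-- The outward unit normal (for the hyperbolic metric) of the sphere about the origin
through `y`. -/
def sphereNormal (y : Euc m) : Euc m := (confFactor y)⁻¹ • (‖y‖⁻¹ • y)

/-- The conformal Killing field `X_a` attached to the ball of hyperbolic radius `R`. -/
def fieldX (R : ℝ) (a y : Euc m) : Euc m :=
  (2 / (1 - euclRadius R ^ 2)) •
    ((inner ℝ y a : ℝ) • y - ((1 / 2 : ℝ) * (‖y‖ ^ 2 + euclRadius R ^ 2)) • a)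

/-- The function `V_a`. -/
def funV (a y : Euc m) : ℝ := 2 * inner ℝ y a / (1 - ‖y‖ ^ 2)

/-- The field `Y_a`. -/
def fieldY (a y : Euc m) : Euc m :=
  ((1 / 2 : ℝ) * (1 + ‖y‖ ^ 2)) • a - (inner ℝ y a : ℝ) • y

end Ambient

section Hypersurface

variable {n : ℕ} [NeZero n] {M : Type*} [TopologicalSpace M]
  [ChartedSpace (EuclideanHalfSpace n) M]

/-- The differential of a map `M → ℝ^{n+1}` at `p`, applied to a tangent vector. -/
def diff (f : M → Euc (n + 1)) (p : M) (v : TangentSpace (𝓡∂ n) p) : Euc (n + 1) :=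
  mfderiv (𝓡∂ n) 𝓘(ℝ, Euc (n + 1)) f p v

/-- The metric on `M` induced by `x`. -/
def inducedMetric (x : M → Euc (n + 1)) (p : M) (v w : TangentSpace (𝓡∂ n) p) : ℝ :=
  hypMetric (x p) (diff x p v) (diff x p w)

/-- The ambient Levi-Civita derivative `∇_v ν` of a field `ν` along `x`. -/
def covDeriv (x ν : M → Euc (n + 1)) (p : M) (v : TangentSpace (𝓡∂ n) p) : Euc (n + 1) :=
  diff ν p v + christoffel (x p) (diff x p v) (ν p)

/-- The second fundamental form `h(v, w) = g(∇_v ν, w)`. -/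
def secondFundamentalForm (x ν : M → Euc (n + 1)) (p : M) (v w : TangentSpace (𝓡∂ n) p) : ℝ :=
  hypMetric (x p) (covDeriv x ν p v) (diff x p w)

/-- The coordinate basis of the tangent space of `M` at `p`. -/
def coordVec (p : M) (i : Fin n) : TangentSpace (𝓡∂ n) p :=
  (EuclideanSpace.single i (1 : ℝ) : Euc n)

/-- The matrix `(h^j_i)` of the Weingarten map in the coordinate basis: the inverse of the matrix
of the induced metric times the matrix of the second fundamental form. -/
def weingarten (x ν : M → Euc (n + 1)) (p : M) : Matrix (Fin n) (Fin n) ℝ :=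
  (Matrix.of fun i j => inducedMetric x p (coordVec p i) (coordVec p j))⁻¹ *
    Matrix.of fun i j => secondFundamentalForm x ν p (coordVec p i) (coordVec p j)

/-- The principal curvatures: the eigenvalues of the Weingarten map, with multiplicity. -/
def principalCurvatures (x ν : M → Euc (n + 1)) (p : M) : Multiset ℝ :=
  (weingarten x ν p).charpoly.roots

/-- The `k`-th mean curvature `σ_k`, the elementary symmetric function of degree `k` of the
principal curvatures (`σ_0 = 1`). -/
def sigma (k : ℕ) (x ν : M → Euc (n + 1)) (p : M) : ℝ :=
  (principalCurvatures x ν p).esymm k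

/-- The density `√det (g_ij)` of the area in the chart of `M` around `q`, at the point of the
half space with coordinates `y`. -/
def chartDensity (x : M → Euc (n + 1)) (q : M) (y : Euc n) : ℝ :=
  let ψ : Euc n → Euc (n + 1) := x ∘ (extChartAt (𝓡∂ n) q).symm
  let d : Fin n → Euc (n + 1) := fun i =>
    fderivWithin ℝ ψ (Set.range (𝓡∂ n)) y (EuclideanSpace.single i (1 : ℝ))
  Real.sqrt (Matrix.det (Matrix.of fun i j : Fin n => hypMetric (ψ y) (d i) (d j)))

/-- The area measure of the induced metric on the domain of the chart around `q`, extended by zero: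
`√det (g_ij) dy₁ ⋯ dy_n` transported to `M`. -/
def chartArea [MeasurableSpace M] (x : M → Euc (n + 1)) (q : M) : Measure M :=
  (((volume : Measure (Euc n)).restrict (extChartAt (𝓡∂ n) q).target).withDensity
    fun y => ENNReal.ofReal (chartDensity x q y)).map (extChartAt (𝓡∂ n) q).symm

/-- The area measure `dA` of the induced metric on `M`. By the change of variables formula any two
of the measures `chartArea x q` agree on the intersection of the chart domains, so their supremum
is the measure that restricts to `√det (g_ij) dy₁ ⋯ dy_n` in each chart. -/
def areaMeasure [MeasurableSpace M] (x : M → Euc (n + 1)) : Measure M :=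
  ⨆ q : M, chartArea x q

/-- `x` is a smooth immersion of `M` in the closed geodesic ball of radius `R` about the origin of
the Poincaré ball, it maps the interior of `M` to the open ball and the boundary of `M` to the
boundary sphere, `ν` is a smooth unit normal field along `x`, and the contact angle of `x` with the
boundary sphere is `θ`. The metric on `M` is the induced one. -/
structure IsCapillaryImmersion (R θ : ℝ) (x ν : M → Euc (n + 1)) : Prop where
  smooth : ContMDiff (𝓡∂ n) 𝓘(ℝ, Euc (n + 1)) ∞ x
  immersion : ∀ p : M, Function.Injective (diff x p)
  map_interior : ∀ p ∈ (𝓡∂ n).interior M, ‖x p‖ < euclRadius R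
  map_boundary : ∀ p ∈ (𝓡∂ n).boundary M, ‖x p‖ = euclRadius R
  smooth_normal : ContMDiff (𝓡∂ n) 𝓘(ℝ, Euc (n + 1)) ∞ ν
  normal_unit : ∀ p : M, hypMetric (x p) (ν p) (ν p) = 1
  normal_orthogonal : ∀ (p : M) (v : TangentSpace (𝓡∂ n) p),
    hypMetric (x p) (ν p) (diff x p v) = 0
  contact_angle : ∀ p ∈ (𝓡∂ n).boundary M,
    hypMetric (x p) (ν p) (sphereNormal (x p)) = Real.cos (Real.pi - θ)

end Hypersurface

end HypBall

end

/-! The proof takes place on the hyperboloid in Minkowski space. Let `Φ` and `N` be the immersion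
and its unit normal seen there, `A` the Weingarten map, `C = cosh R`, `c = sinh R cos θ`, and let `L
= boost a` be the skew generator of a Lorentz boost. The test field is `Z = (a, 0) - L (C Φ + c N)`.
Since `L` is skew, `⟨Z, Φ⟩ = V_a + c g(Y_a, ν)` and `⟨Z, N⟩ = g(X_a, ν)` (`mink_testMap_posMap`,
`mink_testMap_norMap`), so the claim is the Minkowski-type formula `(n - k) ∫ σ_k ⟨Z, Φ⟩ = (k + 1) ∫
σ_{k+1} ⟨Z, N⟩`, with `k` shifted by one.

All `k` are treated at once. In a chart put `w_j = ∂_j Φ + t ∂_j N` and let the flux `F^i` be the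
determinant of `w_1, …, w_n, Φ, N` with `Z` in slot `i`. Up to sign this is the area density times
`adj (1 + t A)`, the generating function of the Newton transforms, applied to the tangential part of
`Z`. In the divergence of `F` the second derivatives of `Φ` and `N` cancel by antisymmetry
(Codazzi), and the derivatives of `Z` contribute the contraction of a symmetric form with a skew
one, which is zero. With `P(t) = det (1 + t A) = ∑ σ_k t^k`, what remains is the density times `⟨Z,
Φ⟩ (n P - t P') - ⟨Z, N⟩ P'` (`IsFrame.divergence`, `sum_update_frame`, `balance_one`).

Along the boundary both `Φ` and `N` have constant height, the latter because the contact angle is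
constant. The conormal of `∂M` in `M` is then a multiple of `C Φ + c N - (0, 1)`, and `Z` was chosen
orthogonal to this vector. Hence the normal component of the flux vanishes
(`tanDet_testField_eq_zero`). The divergence theorem on a half space and a partition of unity show
that the remaining expression integrates to zero for every `t`, and comparing coefficients of `t^k`
finishes the proof. -/

open MeasureTheory
open scoped Manifold ContDiff

namespace HypBall

/-- Minkowski space `ℝ^{n+1,1}`, the ambient space of the hyperboloid model. -/
abbrev Mink (n : ℕ) : Type := Euc (n + 1) × ℝ

/-! ### The Minkowski form and its determinant. -/

section Minkowski

variable {n : ℕ}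

/-- The Minkowski form. -/
noncomputable def mink : Mink n →ₗ[ℝ] Mink n →ₗ[ℝ] ℝ :=
  LinearMap.mk₂ ℝ (fun u v => inner ℝ u.1 v.1 - u.2 * v.2)
    (fun u v w => by simp only [Prod.fst_add, Prod.snd_add, inner_add_left]; ring)
    (fun c u v => by
      simp only [Prod.smul_fst, Prod.smul_snd, inner_smul_left, smul_eq_mul, RCLike.conj_to_real]
      ring)
    (fun u v w => by simp only [Prod.fst_add, Prod.snd_add, inner_add_right]; ring)
    (fun c u v => by
      simp only [Prod.smul_fst, Prod.smul_snd, inner_smul_right, smul_eq_mul]; ring)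

theorem mink_apply (u v : Mink n) : mink u v = inner ℝ u.1 v.1 - u.2 * v.2 := rfl

theorem mink_comm (u v : Mink n) : mink u v = mink v u := by
  simp only [mink_apply, real_inner_comm v.1 u.1, mul_comm]

theorem eq_zero_of_mink_eq_zero {m : Mink n} (h : ∀ v, mink m v = 0) : m = 0 := by
  have h1 := h (m.1, 0)
  have h2 := h (0, m.2)
  simp only [mink_apply, mul_zero, sub_zero, inner_zero_right, zero_sub, neg_eq_zero,
    inner_self_eq_zero, mul_self_eq_zero] at h1 h2
  exact Prod.ext h1 h2

/-- An orthogonal basis of Minkowski space, indexed by the slots of the determinant. -/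
noncomputable def minkBasis (n : ℕ) : Module.Basis (Fin n ⊕ Fin 2) ℝ (Mink n) :=
  ((EuclideanSpace.basisFun (Fin (n + 1)) ℝ).toBasis.prod (Module.Basis.singleton Unit ℝ)).reindex
    (Fintype.equivOfCardEq (by simp))

/-- The determinant on Minkowski space. -/
noncomputable def minkDet (n : ℕ) : Mink n [⋀^Fin n ⊕ Fin 2]→L[ℝ] ℝ :=
  { (minkBasis n).det with
    cont := by
      have : (fun v : Fin n ⊕ Fin 2 → Mink n => (minkBasis n).det v) =
          fun v => Matrix.det (Matrix.of fun i j => (minkBasis n).coord i (v j)) := by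
        ext v; rw [Module.Basis.det_apply]; rfl
      change Continuous fun v : Fin n ⊕ Fin 2 → Mink n => (minkBasis n).det v
      rw [this]
      refine Continuous.matrix_det (continuous_pi fun i => continuous_pi fun j => ?_)
      exact (LinearMap.continuous_of_finiteDimensional ((minkBasis n).coord i)).comp
        (continuous_apply j) }

theorem minkDet_apply (v : Fin n ⊕ Fin 2 → Mink n) : minkDet n v = (minkBasis n).det v := rfl

/-- A determinant vanishes if some nonzero vector is orthogonal to all its rows. -/
theorem minkDet_eq_zero {m : Mink n} (hm : m ≠ 0) {r : Fin n ⊕ Fin 2 → Mink n}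
    (h : ∀ k, mink m (r k) = 0) : minkDet n r = 0 := by
  by_contra h0
  rw [minkDet_apply, ← ne_eq, ← isUnit_iff_ne_zero, ← Module.Basis.is_basis_iff_det] at h0
  refine hm (eq_zero_of_mink_eq_zero fun v => ?_)
  have : Submodule.span ℝ (Set.range r) ≤ LinearMap.ker (mink m) := by
    rw [Submodule.span_le]; rintro _ ⟨k, rfl⟩; exact h k
  exact this (h0.2 ▸ Submodule.mem_top)

theorem eq_zero_of_minkDet_ne_zero {m : Mink n} {r : Fin n ⊕ Fin 2 → Mink n}
    (h0 : minkDet n r ≠ 0) (h : ∀ k, mink m (r k) = 0) : m = 0 := by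
  by_contra hm
  exact h0 (minkDet_eq_zero hm h)

/-- In coordinates the Gram matrix is `Pᵀ J P` with `J = diag(1, …, 1, -1)`, and `det J = -1`
accounts for the sign. -/
theorem minkDet_sq (r : Fin n ⊕ Fin 2 → Mink n) :
    minkDet n r ^ 2 = -(Matrix.of fun i j => mink (r i) (r j)).det := by
  let b' := ((EuclideanSpace.basisFun (Fin (n + 1)) ℝ).toBasis.prod
    (Module.Basis.singleton Unit ℝ))
  let s : Fin (n + 1) ⊕ Unit ≃ Fin n ⊕ Fin 2 := Fintype.equivOfCardEq (by simp)
  let η' : Fin (n + 1) ⊕ Unit → ℝ := Sum.elim (fun _ => 1) (fun _ => -1)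
  have h1 : ∀ u v : Mink n, mink u v = ∑ k, (minkBasis n).repr u k * (η' (s.symm k) *
      (minkBasis n).repr v k) := by
    intro u v
    have : minkBasis n = b'.reindex s := rfl
    rw [this, ← Equiv.sum_comp s]
    simp [b', η', mink_apply, PiLp.inner_apply, mul_comm]
    ring
  have h2 : (Matrix.of fun i j => mink (r i) (r j)) =
      ((minkBasis n).toMatrix r).transpose * (Matrix.diagonal fun k => η' (s.symm k)) *
        (minkBasis n).toMatrix r := by
    ext i j
    simp only [Matrix.of_apply, h1, Matrix.mul_apply (M := _ * _), Matrix.mul_diagonal,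
      Matrix.transpose_apply, Module.Basis.toMatrix_apply, mul_assoc]
  rw [h2, Matrix.det_mul, Matrix.det_mul, Matrix.det_transpose, minkDet_apply,
    Module.Basis.det_apply, Matrix.det_diagonal, Equiv.prod_comp s.symm η']
  simp [η']
  ring

/-- The rows of the determinant: `n` vectors along the hypersurface, position and normal. -/
def rows (w : Fin n → Mink n) (Φ N : Mink n) : Fin n ⊕ Fin 2 → Mink n := Sum.elim w ![Φ, N]

@[simp] theorem rows_inl (w : Fin n → Mink n) (Φ N : Mink n) (i : Fin n) :
    rows w Φ N (Sum.inl i) = w i := rfl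
@[simp] theorem rows_inr_zero (w : Fin n → Mink n) (Φ N : Mink n) :
    rows w Φ N (Sum.inr 0) = Φ := rfl
@[simp] theorem rows_inr_one (w : Fin n → Mink n) (Φ N : Mink n) :
    rows w Φ N (Sum.inr 1) = N := rfl

theorem forall_rows {w : Fin n → Mink n} {Φ N : Mink n} {P : Mink n → Prop} (h : ∀ i, P (w i))
    (hΦ : P Φ) (hN : P N) (k : Fin n ⊕ Fin 2) : P (rows w Φ N k) := by
  rcases k with i | k
  · exact h i
  · fin_cases k
    · exact hΦ
    · exact hN

theorem update_rows_inl (w : Fin n → Mink n) (Φ N v : Mink n) (i : Fin n) :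
    Function.update (rows w Φ N) (Sum.inl i) v = rows (Function.update w i v) Φ N := by
  ext1 k
  rcases k with j | k
  · by_cases h : j = i
    · subst h; simp
    · simp [h]
  · rw [Function.update_of_ne (by simp)]; fin_cases k <;> rfl

theorem update_rows_zero (w : Fin n → Mink n) (Φ N v : Mink n) :
    Function.update (rows w Φ N) (Sum.inr 0) v = rows w v N := by
  ext1 k
  rcases k with j | k
  · simp
  · fin_cases k
    · simp
    · rw [Function.update_of_ne (by simp)]; rfl

theorem update_rows_one (w : Fin n → Mink n) (Φ N v : Mink n) :
    Function.update (rows w Φ N) (Sum.inr 1) v = rows w Φ v := by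
  ext1 k
  rcases k with j | k
  · simp
  · fin_cases k
    · rw [Function.update_of_ne (by simp)]; rfl
    · simp

/-- The determinant with the last two rows fixed, as an alternating map. -/
noncomputable def tanDet (Φ N : Mink n) : Mink n [⋀^Fin n]→ₗ[ℝ] ℝ where
  toFun w := minkDet n (rows w Φ N)
  map_update_add' := by
    intro inst w i x y
    obtain rfl : inst = instDecidableEqFin n := Subsingleton.elim _ _
    have h := (minkDet n).map_update_add (rows w Φ N) (Sum.inl i) x y
    rw [update_rows_inl, update_rows_inl, update_rows_inl] at h
    exact h
  map_update_smul' := by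
    intro inst w i c x
    obtain rfl : inst = instDecidableEqFin n := Subsingleton.elim _ _
    have h := (minkDet n).map_update_smul (rows w Φ N) (Sum.inl i) c x
    rw [update_rows_inl, update_rows_inl] at h
    exact h
  map_eq_zero_of_eq' := by
    intro w i j h hij
    exact (minkDet n).map_eq_zero_of_eq (i := Sum.inl i) (j := Sum.inl j) _ (by simpa using h)
      (by simpa using hij)

theorem tanDet_apply (Φ N : Mink n) (w : Fin n → Mink n) :
    tanDet Φ N w = minkDet n (rows w Φ N) := rfl

/-- Alternating maps in `n` variables multiply by the determinant under linear substitutions. -/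
theorem alternating_matrix {V : Type*} [AddCommGroup V] [Module ℝ V] (d : V [⋀^Fin n]→ₗ[ℝ] ℝ)
    (e : Fin n → V) (M : Matrix (Fin n) (Fin n) ℝ) :
    d (fun k => ∑ l, M l k • e l) = M.det * d e := by
  -- Pulled back along `T`, which sends the standard basis to `e`, the map `d` becomes a form of top
  -- degree on `ℝⁿ`, hence a multiple of the determinant. No independence of `e` is needed.
  let T : (Fin n → ℝ) →ₗ[ℝ] V := Fintype.linearCombination ℝ e
  let b := Pi.basisFun ℝ (Fin n)
  have h := (d.compLinearMap T).eq_smul_basis_det b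
  have h1 : (fun k => ∑ l, M l k • e l) = fun k => T (fun l => M l k) := by
    ext1 k; simp [T, Fintype.linearCombination_apply]
  have h2 : e = fun k => T (b k) := by
    ext1 k; simp [T, b, Fintype.linearCombination_apply, Pi.single_apply, ite_smul]
  have h3 := congrArg (fun d => d fun k l => M l k) h
  have h4 : d.compLinearMap T b = d e := by
    conv_rhs => rw [h2]
    rfl
  rw [h1]
  simp only [AlternatingMap.smul_apply, h4, smul_eq_mul] at h3
  change d (fun k => T fun l => M l k) = _ at h3
  rw [h3, mul_comm, Pi.basisFun_det_apply]
  congr 1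
  exact Matrix.det_transpose M

end Minkowski

end HypBall

namespace HypBall

/-! ### Linear algebra of a frame: Weingarten map and Newton transforms. -/

section Frame

variable {n : ℕ}

theorem hasFDerivAt_minkDet {E : Type*} [NormedAddCommGroup E] [NormedSpace ℝ E]
    {r : Fin n ⊕ Fin 2 → E → Mink n} {r' : Fin n ⊕ Fin 2 → E →L[ℝ] Mink n} {y : E}
    (h : ∀ k, HasFDerivAt (r k) (r' k) y) :
    ∃ D' : E →L[ℝ] ℝ, HasFDerivAt (fun y => minkDet n fun k => r k y) D' y ∧
      ∀ v, D' v = ∑ k, minkDet n (Function.update (fun k => r k y) k (r' k v)) := by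
  refine ⟨_, HasFDerivAt.multilinear_comp (f := (minkDet n).toContinuousMultilinearMap) h, ?_⟩
  intro v
  simp

theorem hasDerivAt_tanDet (w u : Fin n → Mink n) (Φ N : Mink n) (t : ℝ) :
    HasDerivAt (fun s : ℝ => tanDet Φ N fun i => w i + s • u i)
      (∑ i, tanDet Φ N (Function.update (fun i => w i + t • u i) i (u i))) t := by
  let r : Fin n ⊕ Fin 2 → ℝ → Mink n := fun k s => rows (fun i => w i + s • u i) Φ N k
  let r' : Fin n ⊕ Fin 2 → ℝ →L[ℝ] Mink n :=
    fun k => (ContinuousLinearMap.id ℝ ℝ).smulRight (rows u 0 0 k)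
  have h : ∀ k, HasFDerivAt (r k) (r' k) t := by
    intro k
    rcases k with i | k
    · have := (((hasDerivAt_id t).smul_const (u i)).const_add (w i)).hasFDerivAt
      refine this.congr_fderiv ?_
      ext <;> simp [r']
    · fin_cases k
      · refine (hasFDerivAt_const Φ t).congr_fderiv ?_
        ext <;> simp [r']
      · refine (hasFDerivAt_const N t).congr_fderiv ?_
        ext <;> simp [r']
  obtain ⟨D', hD, hv⟩ := hasFDerivAt_minkDet h
  have h1 := hD.hasDerivAt
  rw [hv] at h1
  refine h1.congr_deriv ?_
  rw [Fintype.sum_sum_type, Fin.sum_univ_two]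
  have e1 : (fun k => r k t) = rows (fun i => w i + t • u i) Φ N := rfl
  have e2 : minkDet n (Function.update (fun k => r k t) (Sum.inr 0) (r' (Sum.inr 0) 1)) = 0 :=
    (minkDet n).map_coord_zero (Sum.inr 0) (by simp [r'])
  have e3 : minkDet n (Function.update (fun k => r k t) (Sum.inr 1) (r' (Sum.inr 1) 1)) = 0 :=
    (minkDet n).map_coord_zero (Sum.inr 1) (by simp [r'])
  rw [e2, e3, add_zero, add_zero]
  refine Finset.sum_congr rfl fun i _ => ?_
  rw [e1, update_rows_inl, tanDet_apply]
  simp [r']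

/-- The derivative of the determinant along the frame `w` in the direction `u`. -/
noncomputable def slotSum (Φ N : Mink n) (w u : Fin n → Mink n) : ℝ :=
  ∑ i, tanDet Φ N (Function.update w i (u i))

/-- `slotSum` is the derivative at `s = 0` of the determinant of `w + s u`. By `alternating_matrix`
the substitution multiplies this whole curve by `det M`, so it multiplies the derivative by the same
factor. -/
theorem slotSum_matrix (Φ N : Mink n) (w u : Fin n → Mink n) (M : Matrix (Fin n) (Fin n) ℝ) :
    slotSum Φ N (fun k => ∑ l, M l k • w l) (fun k => ∑ l, M l k • u l) =
      M.det * slotSum Φ N w u := by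
  have h (w u : Fin n → Mink n) :
      HasDerivAt (fun s : ℝ => tanDet Φ N fun i => w i + s • u i) (slotSum Φ N w u) 0 := by
    refine (hasDerivAt_tanDet w u Φ N 0).congr_deriv ?_
    simp only [zero_smul, add_zero, slotSum]
  refine (h _ _).unique (((h w u).const_mul M.det).congr_of_eventuallyEq
    (Filter.Eventually.of_forall fun s => ?_))
  simp only [← alternating_matrix]
  congr 1
  ext1 k
  simp only [smul_add, Finset.sum_add_distrib, Finset.smul_sum]
  congr 1
  exact Finset.sum_congr rfl fun l _ => smul_comm _ _ _

/-- The Gram matrix of a family of vectors. -/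
noncomputable def gram (e : Fin n → Mink n) : Matrix (Fin n) (Fin n) ℝ := Matrix.of fun i j => mink (e i) (e j)

/-- The first order data of a hypersurface of the hyperboloid at a point: tangent frame `e`,
derivatives `b` of the normal along the frame, position `Φ` and normal `N`. -/
structure IsFrame (e b : Fin n → Mink n) (Φ N : Mink n) : Prop where
  pos_pos : mink Φ Φ = -1
  nor_nor : mink N N = 1
  pos_nor : mink Φ N = 0
  frame_pos : ∀ i, mink (e i) Φ = 0
  frame_nor : ∀ i, mink (e i) N = 0
  deriv_pos : ∀ i, mink (b i) Φ = 0
  deriv_nor : ∀ i, mink (b i) N = 0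
  symm : ∀ i j, mink (b i) (e j) = mink (b j) (e i)
  posDef : (gram e).PosDef

/-- The Gram matrix of all rows is block diagonal with blocks `gram e` and `diag(-1, 1)`; the `-1`
from the timelike row cancels the sign in `minkDet_sq`. So `tanDet` is the area density up to sign.
-/
theorem tanDet_sq {e : Fin n → Mink n} {Φ N : Mink n} (pos_pos : mink Φ Φ = -1)
    (nor_nor : mink N N = 1) (pos_nor : mink Φ N = 0) (frame_pos : ∀ i, mink (e i) Φ = 0)
    (frame_nor : ∀ i, mink (e i) N = 0) : tanDet Φ N e ^ 2 = (gram e).det := by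
  rw [tanDet_apply, minkDet_sq]
  have : (Matrix.of fun i j => mink (rows e Φ N i) (rows e Φ N j)) =
      Matrix.fromBlocks (gram e) 0 0 !![-1, 0; 0, 1] := by
    ext i j
    rcases i with i | i <;> rcases j with j | j
    · rfl
    · fin_cases j
      · exact frame_pos i
      · exact frame_nor i
    · fin_cases i
      · exact (mink_comm _ _).trans (frame_pos j)
      · exact (mink_comm _ _).trans (frame_nor j)
    · fin_cases i <;> fin_cases j
      · exact pos_pos
      · exact pos_nor
      · exact (mink_comm _ _).trans pos_nor
      · exact nor_nor
  rw [this, Matrix.det_fromBlocks_zero₂₁]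
  simp

namespace IsFrame

variable {e b : Fin n → Mink n} {Φ N : Mink n}

theorem det_sq (h : IsFrame e b Φ N) : tanDet Φ N e ^ 2 = (gram e).det :=
  tanDet_sq h.pos_pos h.nor_nor h.pos_nor h.frame_pos h.frame_nor

theorem det_ne_zero (h : IsFrame e b Φ N) : tanDet Φ N e ≠ 0 := by
  have := h.posDef.det_pos
  rw [← h.det_sq] at this
  exact fun h0 => by simp [h0] at this

theorem isUnit_gram (h : IsFrame e b Φ N) : IsUnit (gram e).det := h.posDef.det_pos.ne'.isUnit

theorem eq_zero (h : IsFrame e b Φ N) {m : Mink n} (he : ∀ i, mink m (e i) = 0) (hΦ : mink m Φ = 0)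
    (hN : mink m N = 0) : m = 0 :=
  eq_zero_of_minkDet_ne_zero h.det_ne_zero
    (forall_rows (P := fun v => mink m v = 0) he hΦ hN)

/-- The difference of the two sides is orthogonal to `e`, `Φ` and `N`, which span. The `Φ`-term
carries a minus sign because `⟨Φ, Φ⟩ = -1`. -/
theorem expansion (h : IsFrame e b Φ N) (v : Mink n) :
    v = ∑ j, (∑ l, (gram e)⁻¹ j l * mink v (e l)) • e j - mink v Φ • Φ + mink v N • N := by
  rw [← sub_eq_zero]
  refine h.eq_zero (fun i => ?_) ?_ ?_
  · have h1 : ∑ j, (∑ l, (gram e)⁻¹ j l * mink v (e l)) * mink (e j) (e i) = mink v (e i) := by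
      have h2 : (gram e).transpose = gram e := by
        ext i j; exact mink_comm _ _
      have h3 : (gram e).mulVec ((gram e)⁻¹.mulVec fun l => mink v (e l)) =
          fun l => mink v (e l) := by
        rw [Matrix.mulVec_mulVec, Matrix.mul_nonsing_inv _ h.isUnit_gram, Matrix.one_mulVec]
      have h4 := congrFun h3 i
      rw [← h4]
      simp only [Matrix.mulVec, dotProduct, gram, Matrix.of_apply]
      exact Finset.sum_congr rfl fun j _ => by rw [mul_comm, mink_comm (e j)]
    simp only [map_sub, map_add, map_sum, map_smul, LinearMap.sub_apply, LinearMap.add_apply,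
      LinearMap.sum_apply, LinearMap.smul_apply, smul_eq_mul, h1, mink_comm Φ, mink_comm N,
      h.frame_pos, h.frame_nor]
    ring
  · simp only [map_sub, map_add, map_sum, map_smul, LinearMap.sub_apply, LinearMap.add_apply,
      LinearMap.sum_apply, LinearMap.smul_apply, smul_eq_mul, h.frame_pos, h.pos_pos,
      mink_comm N, h.pos_nor]
    simp
  · simp only [map_sub, map_add, map_sum, map_smul, LinearMap.sub_apply, LinearMap.add_apply,
      LinearMap.sum_apply, LinearMap.smul_apply, smul_eq_mul, h.frame_nor, h.nor_nor, h.pos_nor]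
    simp

end IsFrame

/-- The matrix of the Weingarten map in a frame. -/
noncomputable def shape (e b : Fin n → Mink n) : Matrix (Fin n) (Fin n) ℝ :=
  (gram e)⁻¹ * Matrix.of fun i j => mink (b i) (e j)

theorem gram_symm (e : Fin n → Mink n) : (gram e).transpose = gram e := by ext i j; exact mink_comm _ _

/-- A matrix commutes with its adjugate. Applied to `1 + t A`, the summand `1` and the factor `t ≠
0` cancel. -/
theorem shape_comm (e b : Fin n → Mink n) (t : ℝ) : shape e b * (1 + t • shape e b).adjugate =
    (1 + t • shape e b).adjugate * shape e b := by
  by_cases ht : t = 0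
  · simp [ht]
  have h1 := (Matrix.mul_adjugate (1 + t • shape e b)).trans
    (Matrix.adjugate_mul (1 + t • shape e b)).symm
  rw [add_mul, mul_add, Matrix.one_mul, Matrix.mul_one, Matrix.smul_mul, Matrix.mul_smul] at h1
  exact smul_right_injective _ ht (add_left_cancel h1)

theorem sum_symm_mul_skew {S : Matrix (Fin n) (Fin n) ℝ} {K : Fin n → Fin n → ℝ} (hS : S.transpose = S)
    (hK : ∀ i j, K i j = -K j i) : ∑ i, ∑ j, S i j * K i j = 0 := by
  have h1 : ∑ i, ∑ j, S i j * K i j = -∑ i, ∑ j, S i j * K i j := by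
    conv_lhs => rw [Finset.sum_comm]
    rw [← Finset.sum_neg_distrib]
    refine Finset.sum_congr rfl fun i _ => ?_
    rw [← Finset.sum_neg_distrib]
    refine Finset.sum_congr rfl fun j _ => ?_
    rw [hK j i, ← Matrix.transpose_apply S, hS]
    ring
  linarith

namespace IsFrame

variable {e b : Fin n → Mink n} {Φ N : Mink n}

theorem deriv_eq (h : IsFrame e b Φ N) (j : Fin n) : b j = ∑ l, shape e b l j • e l := by
  conv_lhs => rw [h.expansion (b j), h.deriv_pos, h.deriv_nor]
  simp only [zero_smul, sub_zero, add_zero, shape, Matrix.mul_apply, Matrix.of_apply]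
  exact Finset.sum_congr rfl fun l _ => by simp only [h.symm j]

theorem variation_eq (h : IsFrame e b Φ N) (t : ℝ) : (fun j => e j + t • b j) =
    fun j => ∑ l, (1 + t • shape e b) l j • e l := by
  ext1 j
  simp only [Matrix.add_apply, Matrix.smul_apply, add_smul, Finset.sum_add_distrib,
    Matrix.one_apply, ite_smul, one_smul, zero_smul, Finset.sum_ite_eq', Finset.mem_univ, if_true,
    smul_eq_mul, mul_smul, ← Finset.smul_sum, ← h.deriv_eq]

theorem tanDet_variation (h : IsFrame e b Φ N) (t : ℝ) : tanDet Φ N (fun j => e j + t • b j) =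
    (1 + t • shape e b).det * tanDet Φ N e := by
  rw [h.variation_eq, alternating_matrix]

/-- Cramer's rule. As a function of the vector in slot `i` the determinant is a linear functional
that kills `Φ` and `N` and takes on `e j` the entry `(i, j)` of `adj (1 + t A)`, up to the common
factor `tanDet Φ N e`. The factor `(gram e)⁻¹` reads off the tangential coordinates of `v`. -/
theorem tanDet_update (h : IsFrame e b Φ N) (t : ℝ) (i : Fin n) (v : Mink n) :
    tanDet Φ N (Function.update (fun j => e j + t • b j) i v) = tanDet Φ N e *
      ∑ l, ((1 + t • shape e b).adjugate * (gram e)⁻¹) i l * mink v (e l) := by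
  set w := fun j => e j + t • b j with hw
  set M := 1 + t • shape e b with hM
  let δ : Mink n →ₗ[ℝ] ℝ := (tanDet Φ N).toMultilinearMap.toLinearMap w i
  have hδ : ∀ v, tanDet Φ N (Function.update w i v) = δ v := fun v => rfl
  have hδΦ : δ Φ = 0 := by
    rw [← hδ, tanDet_apply]
    exact (minkDet n).map_eq_zero_of_eq (i := Sum.inl i) (j := Sum.inr 0) _ (by simp) (by simp)
  have hδN : δ N = 0 := by
    rw [← hδ, tanDet_apply]
    exact (minkDet n).map_eq_zero_of_eq (i := Sum.inl i) (j := Sum.inr 1) _ (by simp) (by simp)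
  have hδe : ∀ j, δ (e j) = M.adjugate i j * tanDet Φ N e := by
    intro j
    have h1 : Function.update w i (e j) =
        fun k => ∑ l, (M.updateCol i (Pi.single j 1)) l k • e l := by
      ext1 k
      by_cases hk : k = i
      · subst hk; simp [Pi.single_apply, ite_smul]
      · simp only [Function.update_of_ne hk, Matrix.updateCol_apply, if_neg hk]
        exact congrFun (h.variation_eq t) k
    rw [← hδ, h1, alternating_matrix]
    congr 1
    rw [← Matrix.transpose_apply M.adjugate, Matrix.adjugate_transpose, Matrix.adjugate_apply,
      ← Matrix.det_transpose, ← Matrix.updateRow_transpose]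
  rw [hδ]
  conv_lhs => rw [h.expansion v]
  simp only [map_add, map_sub, map_sum, map_smul, hδΦ, hδN, hδe, smul_eq_mul, mul_zero, sub_zero,
    add_zero, Matrix.mul_apply, Finset.sum_mul, Finset.mul_sum]
  rw [Finset.sum_comm]
  exact Finset.sum_congr rfl fun l _ => Finset.sum_congr rfl fun j _ => by ring

/-- `M = 1 + t A` is self-adjoint for the metric `G = gram e`, that is `Mᵀ G = G M`. Taking
adjugates reverses the products, and `adj G = det G • G⁻¹`. -/
theorem adjugate_symm (h : IsFrame e b Φ N) (t : ℝ) :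
    (gram e)⁻¹ * (1 + t • shape e b).adjugate.transpose =
      (1 + t • shape e b).adjugate * (gram e)⁻¹ := by
  set M := 1 + t • shape e b with hM
  have hG := gram_symm e
  have hu := h.isUnit_gram
  have h1 : M.transpose * gram e = gram e * M := by
    have hH : (Matrix.of fun i j => mink (b i) (e j)).transpose =
        Matrix.of fun i j => mink (b i) (e j) := by
      ext i j; exact h.symm j i
    rw [hM, Matrix.transpose_add, Matrix.transpose_smul, shape, Matrix.transpose_mul, hH,
      Matrix.transpose_nonsing_inv, hG, Matrix.transpose_one, add_mul, mul_add, Matrix.one_mul,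
      Matrix.mul_one, Matrix.smul_mul, Matrix.mul_smul, Matrix.mul_assoc,
      Matrix.nonsing_inv_mul _ hu, Matrix.mul_one, Matrix.mul_nonsing_inv_cancel_left _ _ hu]
  have h2 := congrArg Matrix.adjugate h1
  rw [Matrix.adjugate_mul_distrib, Matrix.adjugate_mul_distrib, ← Matrix.adjugate_transpose] at h2
  have hadj : (gram e).adjugate = (gram e).det • (gram e)⁻¹ := by
    rw [Matrix.inv_def, smul_smul, Ring.mul_inverse_cancel _ hu, one_smul]
  rw [hadj, Matrix.smul_mul, Matrix.mul_smul] at h2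
  exact (smul_right_injective _ hu.ne_zero) h2

/-- By `tanDet_update` the sum contracts the symmetric matrix `adj (1 + t A) G⁻¹` with the skew
matrix `⟨L e_i, e_l⟩`. This and `sum_skew_deriv` remove the derivative of the test field from the
divergence. -/
theorem sum_skew_frame (h : IsFrame e b Φ N) (t : ℝ) (L : Mink n →ₗ[ℝ] Mink n)
    (hL : ∀ u v, mink (L u) v = -mink u (L v)) :
    ∑ i, tanDet Φ N (Function.update (fun j => e j + t • b j) i (L (e i))) = 0 := by
  simp only [h.tanDet_update, ← Finset.mul_sum]
  have h1 : ((1 + t • shape e b).adjugate * (gram e)⁻¹).transpose =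
      (1 + t • shape e b).adjugate * (gram e)⁻¹ := by
    rw [Matrix.transpose_mul, Matrix.transpose_nonsing_inv, gram_symm e, h.adjugate_symm]
  rw [sum_symm_mul_skew (K := fun i l => mink (L (e i)) (e l)) h1, mul_zero]
  intro i j
  simp only [hL (e i), mink_comm (e i)]

/-- Expanding `b i` in the frame inserts a factor `A`. The matrix `A adj (1 + t A) G⁻¹` is still
symmetric, because `A` is self-adjoint and commutes with the adjugate, so its contraction with `⟨L
e_k, e_l⟩` vanishes. -/
theorem sum_skew_deriv (h : IsFrame e b Φ N) (t : ℝ) (L : Mink n →ₗ[ℝ] Mink n)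
    (hL : ∀ u v, mink (L u) v = -mink u (L v)) :
    ∑ i, tanDet Φ N (Function.update (fun j => e j + t • b j) i (L (b i))) = 0 := by
  simp only [h.tanDet_update, ← Finset.mul_sum]
  set S := (1 + t • shape e b).adjugate * (gram e)⁻¹ with hS
  have hST : S.transpose = S := by
    rw [hS, Matrix.transpose_mul, Matrix.transpose_nonsing_inv, gram_symm e, h.adjugate_symm]
  have hH : (Matrix.of fun i j => mink (b i) (e j)).transpose =
      Matrix.of fun i j => mink (b i) (e j) := by
    ext i j; exact h.symm j i
  have h1 : (shape e b * S).transpose = shape e b * S := by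
    rw [Matrix.transpose_mul, hST, hS, shape, Matrix.transpose_mul, hH,
      Matrix.transpose_nonsing_inv, gram_symm e, ← shape, ← Matrix.mul_assoc (shape e b),
      shape_comm e b, shape]
    simp only [Matrix.mul_assoc]
  have h2 : ∑ i, ∑ l, S i l * mink (L (b i)) (e l) =
      ∑ k, ∑ l, (shape e b * S) k l * mink (L (e k)) (e l) := by
    simp only [Matrix.mul_apply, Finset.sum_mul]
    have : ∀ i l, S i l * mink (L (b i)) (e l) =
        ∑ k, shape e b k i * S i l * mink (L (e k)) (e l) := by
      intro i l
      conv_lhs => rw [h.deriv_eq i]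
      simp only [map_sum, map_smul, LinearMap.sum_apply, LinearMap.smul_apply, Finset.mul_sum,
        smul_eq_mul]
      exact Finset.sum_congr rfl fun k _ => by ring
    simp only [this]
    rw [Finset.sum_comm]
    rw [Finset.sum_comm' (t' := Finset.univ) (s' := fun _ => Finset.univ) (by simp)]
    conv_lhs => enter [2, i]; rw [Finset.sum_comm]
    rw [Finset.sum_comm]
    exact Finset.sum_congr rfl fun k _ => Finset.sum_comm
  rw [h2, sum_symm_mul_skew (K := fun i l => mink (L (e i)) (e l)) h1, mul_zero]
  intro i j
  simp only [hL (e i), mink_comm (e i)]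

theorem hasDerivAt_det (h : IsFrame e b Φ N)
    (t : ℝ) : HasDerivAt (fun s : ℝ => (1 + s • shape e b).det)
    ((∑ i, tanDet Φ N (Function.update (fun j => e j + t • b j) i (b i))) / tanDet Φ N e) t := by
  refine ((hasDerivAt_tanDet e b Φ N t).div_const (tanDet Φ N e)).congr_of_eventuallyEq
    (Filter.Eventually.of_forall fun s => ?_)
  simp only [h.tanDet_variation, mul_div_cancel_right₀ _ h.det_ne_zero]

/-- Slot `i` of the variation holds `e i + t • b i`, so by linearity in that slot each term with `e
i` plus `t` times the term with `b i` is the full determinant. With `hasDerivAt_det` this is `n P -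
t P'` for `P(t) = det (1 + t A)`, up to the factor `tanDet Φ N e`. -/
theorem sum_update_frame (h : IsFrame e b Φ N) (t : ℝ) :
    ∑ i, tanDet Φ N (Function.update (fun j => e j + t • b j) i (e i)) =
      n * ((1 + t • shape e b).det * tanDet Φ N e) -
        t * ∑ i, tanDet Φ N (Function.update (fun j => e j + t • b j) i (b i)) := by
  rw [eq_sub_iff_add_eq, Finset.mul_sum, ← Finset.sum_add_distrib, ← h.tanDet_variation]
  have : ∀ i, tanDet Φ N (Function.update (fun j => e j + t • b j) i (e i)) +
      t * tanDet Φ N (Function.update (fun j => e j + t • b j) i (b i)) =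
      tanDet Φ N (fun j => e j + t • b j) := by
    intro i
    rw [← smul_eq_mul, ← (tanDet Φ N).map_update_smul, ← (tanDet Φ N).map_update_add]
    congr 1
    exact Function.update_eq_self i (fun j => e j + t • b j)
  simp [this]

end IsFrame

end Frame

end HypBall

namespace HypBall

/-! ### Elementary symmetric functions of the curvatures, and the divergence of the flux. -/

section Frame

variable {n : ℕ}

open scoped MatrixOrder in
-- Writing `G⁻¹ = Bᵀ B`, the matrix `Bᵀ (B H)` has the same characteristic polynomial as the
-- symmetric matrix `B H Bᵀ`. Thus all principal curvatures are real and none is missing from the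
-- multiset of roots.
theorem charpoly_splits_of_posDef {G H : Matrix (Fin n) (Fin n) ℝ} (hG : G.PosDef)
    (hH : H.transpose = H) : (G⁻¹ * H).charpoly.Splits := by
  obtain ⟨B, hB⟩ := CStarAlgebra.nonneg_iff_eq_star_mul_self.mp hG.inv.posSemidef.nonneg
  rw [hB, mul_assoc, Matrix.charpoly_mul_comm]
  refine Matrix.IsHermitian.splits_charpoly ?_
  rw [Matrix.IsHermitian, Matrix.star_eq_conjTranspose, Matrix.conjTranspose_eq_transpose_of_trivial,
    Matrix.conjTranspose_eq_transpose_of_trivial, Matrix.transpose_mul, Matrix.transpose_mul,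
    Matrix.transpose_transpose, hH, mul_assoc]

/-- The left side is the reversed characteristic polynomial at `-t`. Vieta's formulas give its
coefficients, and their signs cancel those of `(-t)^k`. -/
theorem det_one_add_smul_eq_sum_esymm {A : Matrix (Fin n) (Fin n) ℝ} (hA : A.charpoly.Splits)
    (t : ℝ) : (1 + t • A).det = ∑ k ∈ Finset.range (n + 1), A.charpoly.roots.esymm k * t ^ k := by
  have hnd : A.charpoly.natDegree = n := by simp
  have h1 : (1 + t • A).det = A.charpolyRev.eval (-t) := by
    rw [Matrix.charpolyRev, ← Polynomial.coe_evalRingHom, RingHom.map_det]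
    congr 1
    ext i j
    simp [Matrix.one_apply, apply_ite]
    ring
  have h2 : A.charpolyRev.natDegree < n + 1 := by
    rw [← Matrix.reverse_charpoly, Nat.lt_succ_iff]
    exact (Polynomial.reverse_natDegree_le _).trans hnd.le
  rw [h1, Polynomial.eval_eq_sum_range' h2]
  refine Finset.sum_congr rfl fun k hk => ?_
  have hk' : k ≤ n := Nat.lt_succ_iff.mp (Finset.mem_range.mp hk)
  rw [← Matrix.reverse_charpoly, Polynomial.coeff_reverse, hnd, Polynomial.revAt_le hk',
    Polynomial.coeff_eq_esymm_roots_of_splits hA (by rw [hnd]; omega), hnd,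
    A.charpoly_monic.leadingCoeff, Nat.sub_sub_self hk', one_mul, neg_pow t,
    mul_right_comm, mul_comm _ (A.charpoly.roots.esymm k), ← mul_assoc ((-1 : ℝ) ^ k), ← mul_pow]
  simp

theorem sum_antisymm {a : Fin n → Fin n → ℝ} (h : ∀ i j, a i j = -a j i) :
    ∑ i, ∑ j, a i j = 0 := by
  have h1 : ∑ i, ∑ j, a i j = -∑ i, ∑ j, a i j := by
    conv_lhs => rw [Finset.sum_comm]
    simp only [← Finset.sum_neg_distrib]
    exact Finset.sum_congr rfl fun i _ => Finset.sum_congr rfl fun j _ => h j i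
  linarith

theorem tanDet_update_update (Φ N : Mink n) (w : Fin n → Mink n) {i j : Fin n} (hij : i ≠ j)
    (z v : Mink n) : tanDet Φ N (Function.update (Function.update w i z) j v) =
      -tanDet Φ N (Function.update (Function.update w j z) i v) := by
  rw [← (tanDet Φ N).map_swap (Function.update (Function.update w j z) i v) hij]
  congr 1
  ext1 k
  simp only [Function.comp_apply, Function.update_apply, Equiv.swap_apply_def]
  split_ifs <;> simp_all

namespace IsFrame

variable {e b : Fin n → Mink n} {Φ N : Mink n}

theorem variation_pos (h : IsFrame e b Φ N) (t : ℝ) (j : Fin n) : mink (e j + t • b j) Φ = 0 := by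
  simp [h.frame_pos, h.deriv_pos]

theorem variation_nor (h : IsFrame e b Φ N) (t : ℝ) (j : Fin n) : mink (e j + t • b j) N = 0 := by
  simp [h.frame_nor, h.deriv_nor]

theorem pos_ne_zero (h : IsFrame e b Φ N) : Φ ≠ 0 := by
  rintro rfl; simpa using h.pos_pos

theorem nor_ne_zero (h : IsFrame e b Φ N) : N ≠ 0 := by
  rintro rfl; simpa using h.nor_nor

/-- With `e i` in place of `Φ`, all rows except `z` are orthogonal to `Φ`. Replacing `z` by its
projection `z + ⟨z, Φ⟩ Φ` makes the determinant vanish, so only the `Φ`-component of `z` counts;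
exchanging two rows brings `Φ` back to its place. -/
theorem det_update_pos (h : IsFrame e b Φ N) (t : ℝ) (z : Mink n) (i : Fin n) :
    minkDet n (rows (Function.update (fun j => e j + t • b j) i z) (e i) N) =
      mink z Φ * tanDet Φ N (Function.update (fun j => e j + t • b j) i (e i)) := by
  set w := fun j => e j + t • b j with hw
  have h1 : minkDet n (rows (Function.update w i (z + mink z Φ • Φ)) (e i) N) = 0 := by
    refine minkDet_eq_zero h.pos_ne_zero
      (forall_rows (P := fun v => mink Φ v = 0) (fun j => ?_) ?_ ?_)
    · by_cases hj : j = i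
      · subst hj
        simp [h.pos_pos, mink_comm Φ z]
      · rw [Function.update_of_ne hj, mink_comm]; exact h.variation_pos t j
    · rw [mink_comm]; exact h.frame_pos i
    · exact h.pos_nor
  have h2 : minkDet n (rows (Function.update w i Φ) (e i) N) =
      -minkDet n (rows (Function.update w i (e i)) Φ N) := by
    refine Eq.trans ?_ ((minkDet n).toAlternatingMap.map_swap (rows (Function.update w i (e i)) Φ N)
      (show (Sum.inl i : Fin n ⊕ Fin 2) ≠ Sum.inr 0 by simp))
    change minkDet n _ = minkDet n _
    congr 1
    rw [Equiv.comp_swap_eq_update, rows_inl, rows_inr_zero, update_rows_zero, update_rows_inl,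
      Function.update_self, Function.update_idem]
  have h3 : minkDet n (rows (Function.update w i (z + mink z Φ • Φ)) (e i) N) =
      minkDet n (rows (Function.update w i z) (e i) N) +
        mink z Φ * minkDet n (rows (Function.update w i Φ) (e i) N) := by
    rw [← tanDet_apply, (tanDet (e i) N).map_update_add, (tanDet (e i) N).map_update_smul]
    rfl
  rw [tanDet_apply]
  linear_combination h1 - h3 - mink z Φ * h2

/-- The argument of `det_update_pos` with `N` in the role of `Φ`. The sign changes because `⟨N, N⟩ =
1`. -/
theorem det_update_nor (h : IsFrame e b Φ N) (t : ℝ) (z : Mink n) (i : Fin n) :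
    minkDet n (rows (Function.update (fun j => e j + t • b j) i z) Φ (b i)) =
      -(mink z N * tanDet Φ N (Function.update (fun j => e j + t • b j) i (b i))) := by
  set w := fun j => e j + t • b j with hw
  have h1 : minkDet n (rows (Function.update w i (z + (-mink z N) • N)) Φ (b i)) = 0 := by
    refine minkDet_eq_zero h.nor_ne_zero
      (forall_rows (P := fun v => mink N v = 0) (fun j => ?_) ?_ ?_)
    · by_cases hj : j = i
      · subst hj
        simp [h.nor_nor, mink_comm N z]
      · rw [Function.update_of_ne hj, mink_comm]; exact h.variation_nor t j
    · rw [mink_comm]; exact h.pos_nor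
    · rw [mink_comm]; exact h.deriv_nor i
  have h2 : minkDet n (rows (Function.update w i N) Φ (b i)) =
      -minkDet n (rows (Function.update w i (b i)) Φ N) := by
    refine Eq.trans ?_ ((minkDet n).toAlternatingMap.map_swap (rows (Function.update w i (b i)) Φ N)
      (show (Sum.inl i : Fin n ⊕ Fin 2) ≠ Sum.inr 1 by simp))
    change minkDet n _ = minkDet n _
    congr 1
    rw [Equiv.comp_swap_eq_update, rows_inl, rows_inr_one, update_rows_one, update_rows_inl,
      Function.update_self, Function.update_idem]
  have h3 : minkDet n (rows (Function.update w i (z + (-mink z N) • N)) Φ (b i)) =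
      minkDet n (rows (Function.update w i z) Φ (b i)) +
        (-mink z N) * minkDet n (rows (Function.update w i N) Φ (b i)) := by
    rw [← tanDet_apply, (tanDet Φ (b i)).map_update_add, (tanDet Φ (b i)).map_update_smul]
    rfl
  rw [tanDet_apply]
  linear_combination h1 - h3 + mink z N * h2

/-- The divergence of the flux `i ↦ tanDet Φ N (update w i z)`, for a variation `w` whose
derivatives `c` satisfy the Codazzi equations. -/
theorem divergence (h : IsFrame e b Φ N)
    (t : ℝ) (z : Mink n) (z' : Fin n → Mink n) (c : Fin n → Fin n → Mink n)
    (hc : ∀ i j, c i j = c j i) :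
    ∑ i, ∑ k, minkDet n (Function.update
        (rows (Function.update (fun j => e j + t • b j) i z) Φ N) k
        (rows (Function.update (c i) i (z' i)) (e i) (b i) k)) =
      ∑ i, tanDet Φ N (Function.update (fun j => e j + t • b j) i (z' i)) +
        mink z Φ * ∑ i, tanDet Φ N (Function.update (fun j => e j + t • b j) i (e i)) -
        mink z N * ∑ i, tanDet Φ N (Function.update (fun j => e j + t • b j) i (b i)) := by
  set w := fun j => e j + t • b j with hw
  -- Product rule over the rows: slot `i` yields `z'`, the other slots `j` yield the second
  -- derivatives `c i j`, and the last two rows are covered by `det_update_pos` and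
  -- `det_update_nor`.
  have h1 : ∀ i, ∑ k, minkDet n (Function.update (rows (Function.update w i z) Φ N) k
        (rows (Function.update (c i) i (z' i)) (e i) (b i) k)) =
      (tanDet Φ N (Function.update w i (z' i)) + ∑ j, if j = i then 0 else
        tanDet Φ N (Function.update (Function.update w i z) j (c i j))) +
        (mink z Φ * tanDet Φ N (Function.update w i (e i)) +
        -(mink z N * tanDet Φ N (Function.update w i (b i)))) := by
    intro i
    rw [Fintype.sum_sum_type, Fin.sum_univ_two, update_rows_zero, update_rows_one, rows_inr_zero,
      rows_inr_one, h.det_update_pos, h.det_update_nor]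
    congr 1
    have : tanDet Φ N (Function.update w i (z' i)) =
        ∑ j, if j = i then tanDet Φ N (Function.update w i (z' i)) else 0 := by simp
    rw [this, ← Finset.sum_add_distrib]
    refine Finset.sum_congr rfl fun j _ => ?_
    rw [update_rows_inl, rows_inl, ← tanDet_apply]
    by_cases hj : j = i
    · subst hj; simp
    · simp [hj]
  -- Codazzi: `c i j` is symmetric, while the determinant with `z` in slot `i` and `c i j` in slot
  -- `j` changes sign when `i` and `j` are exchanged.
  have h2 : ∑ i, ∑ j, (if j = i then 0 else
      tanDet Φ N (Function.update (Function.update w i z) j (c i j))) = 0 := by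
    refine sum_antisymm fun i j => ?_
    by_cases hij : j = i
    · simp [hij]
    · rw [if_neg hij, if_neg (Ne.symm hij), tanDet_update_update _ _ _ (Ne.symm hij), hc]
  simp only [h1, Finset.sum_add_distrib, h2, Finset.sum_neg_distrib, ← Finset.mul_sum]
  ring

end IsFrame

end Frame

/-! ### Lorentz boosts and the test field at the boundary. -/

section Fields

variable {n : ℕ}

/-- The infinitesimal Lorentz boost in the direction `a`. -/
noncomputable def boost (a : Euc (n + 1)) : Mink n →ₗ[ℝ] Mink n where
  toFun v := (v.2 • a, inner ℝ v.1 a)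
  map_add' u v := by simp [add_smul, inner_add_left]
  map_smul' c v := by simp [mul_smul, inner_smul_left]

theorem mink_boost (a : Euc (n + 1)) (u v : Mink n) :
    mink (boost a u) v = -mink u (boost a v) := by
  simp only [mink_apply, boost, LinearMap.coe_mk, AddHom.coe_mk, inner_smul_left,
    inner_smul_right, RCLike.conj_to_real, real_inner_comm a]
  ring

/-- The ambient vector field whose Newton transform is tangent to the boundary. -/
noncomputable def testField (C c : ℝ) (a : Euc (n + 1)) (Φ N : Mink n) : Mink n :=
  (a, 0) - boost a (C • Φ + c • N)

/-- The flux is tangent to the boundary, where position and normal have constant height. -/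
theorem tanDet_testField_eq_zero {C c : ℝ} (a : Euc (n + 1)) {Φ N : Mink n} (hc : c ^ 2 < C ^ 2 - 1)
    (pos_pos : mink Φ Φ = -1) (nor_nor : mink N N = 1) (pos_nor : mink Φ N = 0)
    (hΦ : Φ.2 = C) (hN : N.2 = -c) {w : Fin n → Mink n} (i : Fin n)
    (wΦ : ∀ j, mink (w j) Φ = 0) (wN : ∀ j, mink (w j) N = 0) (w2 : ∀ j ≠ i, (w j).2 = 0) :
    tanDet Φ N (Function.update w i (testField C c a Φ N)) = 0 := by
  -- Since `⟨(0, 1), Φ⟩ = -C` and `⟨(0, 1), N⟩ = c`, this is minus the part of `(0, 1)` orthogonal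
  -- to `Φ` and `N`: the gradient of the height along the hypersurface, hence a conormal of the
  -- boundary. All rows turn out to be orthogonal to it.
  let m : Mink n := C • Φ - (0, 1) + c • N
  have hm : ∀ v, mink m v = C * mink v Φ + v.2 + c * mink v N := by
    intro v
    simp only [m, map_add, map_sub, map_smul, LinearMap.add_apply, LinearMap.sub_apply,
      LinearMap.smul_apply, smul_eq_mul, mink_comm v]
    simp [mink_apply]
  refine minkDet_eq_zero (m := m) (fun h0 => ?_)
    (forall_rows (P := fun v => mink m v = 0) (fun j => ?_) ?_ ?_)
  -- The height of `m` is `C² - 1 - c²`, which is positive by `hc`.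
  · have := congrArg Prod.snd h0
    simp [m, hΦ, hN] at this
    nlinarith
  · by_cases hj : j = i
    · subst hj
      rw [Function.update_self, hm]
      -- In `C • e1 + e3 + c • e2` the terms with `⟨N, L Φ⟩` cancel each other and those with `a`
      -- cancel `e3`. This is what dictates the coefficients `C` and `c` in `testField`.
      have e1 : mink (testField C c a Φ N) Φ = inner ℝ a Φ.1 + c * mink N (boost a Φ) := by
        have := mink_boost a Φ Φ
        rw [mink_comm (boost a Φ)] at this
        have h0 : mink Φ (boost a Φ) = 0 := by linarith
        simp only [testField, map_sub, LinearMap.sub_apply, mink_boost, map_add, map_smul,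
          LinearMap.add_apply, LinearMap.smul_apply, smul_eq_mul, h0]
        simp [mink_apply]
        ring
      have e2 : mink (testField C c a Φ N) N = inner ℝ a N.1 - C * mink N (boost a Φ) := by
        have := mink_boost a N N
        rw [mink_comm (boost a N)] at this
        have h0 : mink N (boost a N) = 0 := by linarith
        have h1 : mink Φ (boost a N) = -mink N (boost a Φ) := by
          rw [mink_comm N, mink_boost, neg_neg]
        simp only [testField, map_sub, LinearMap.sub_apply, mink_boost, map_add, map_smul,
          LinearMap.add_apply, LinearMap.smul_apply, smul_eq_mul, h0, h1]
        simp [mink_apply]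
      have e3 : (testField C c a Φ N).2 = -(C * inner ℝ a Φ.1 + c * inner ℝ a N.1) := by
        simp only [testField, boost, LinearMap.coe_mk, AddHom.coe_mk, Prod.snd_sub, Prod.fst_add,
          Prod.smul_fst, real_inner_comm a, inner_add_right, inner_smul_right]
        ring
      rw [e1, e2, e3]
      ring
    · rw [Function.update_of_ne hj, hm, wΦ, wN, w2 j hj]; simp
  · rw [hm, pos_pos, hΦ, pos_nor]; ring
  · rw [hm, nor_nor, hN, mink_comm, pos_nor]; ring

end Fields

end HypBall

namespace HypBall

/-! ### The isometry from the Poincaré ball to the hyperboloid. -/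

section Model

variable {n : ℕ}

theorem one_sub_norm_sq_pos {y : Euc (n + 1)} (hy : ‖y‖ < 1) : 0 < 1 - ‖y‖ ^ 2 := by
  nlinarith [norm_nonneg y]

theorem confFactor_pos {y : Euc (n + 1)} (hy : ‖y‖ < 1) : 0 < confFactor y :=
  div_pos two_pos (one_sub_norm_sq_pos hy)

theorem confFactor_mul_norm_sq {y : Euc (n + 1)} (hy : ‖y‖ < 1) :
    confFactor y * ‖y‖ ^ 2 = confFactor y - 2 := by
  have := (one_sub_norm_sq_pos hy).ne'
  rw [confFactor]
  field_simp
  ring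

/-- The isometry from the Poincaré ball to the hyperboloid. -/
noncomputable def hypPos (y : Euc (n + 1)) : Mink n := (confFactor y • y, confFactor y - 1)

/-- The differential of the isometry `hypPos` at `y`. -/
noncomputable def push (y : Euc (n + 1)) : Euc (n + 1) →L[ℝ] Mink n :=
  LinearMap.toContinuousLinearMap
    { toFun := fun v => (confFactor y • v + (confFactor y ^ 2 * inner ℝ y v) • y,
        confFactor y ^ 2 * inner ℝ y v)
      map_add' := fun u v => by
        refine Prod.ext ?_ ?_
        · simp only [inner_add_right, Prod.fst_add]; module
        · simp only [inner_add_right, Prod.snd_add]; ring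
      map_smul' := fun c v => by
        refine Prod.ext ?_ ?_
        · simp only [inner_smul_right, Prod.smul_fst, RingHom.id_apply]; module
        · simp only [inner_smul_right, Prod.smul_snd, RingHom.id_apply, smul_eq_mul]; ring }

theorem push_apply (y v : Euc (n + 1)) :
    push y v = (confFactor y • v + (confFactor y ^ 2 * inner ℝ y v : ℝ) • y,
      confFactor y ^ 2 * inner ℝ y v) := rfl

theorem mink_hypPos {y : Euc (n + 1)} (hy : ‖y‖ < 1) : mink (hypPos y) (hypPos y) = -1 := by
  have h := confFactor_mul_norm_sq hy
  simp only [mink_apply, hypPos, inner_smul_left, inner_smul_right, RCLike.conj_to_real,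
    real_inner_self_eq_norm_sq]
  linear_combination confFactor y * h

theorem mink_push_hypPos {y : Euc (n + 1)} (hy : ‖y‖ < 1) (v : Euc (n + 1)) :
    mink (push y v) (hypPos y) = 0 := by
  have h := confFactor_mul_norm_sq hy
  simp only [mink_apply, hypPos, push_apply, inner_smul_left, inner_smul_right, inner_add_left,
    RCLike.conj_to_real, real_inner_self_eq_norm_sq, real_inner_comm y v]
  linear_combination confFactor y ^ 2 * inner ℝ y v * h

theorem mink_push_push {y : Euc (n + 1)} (hy : ‖y‖ < 1) (v w : Euc (n + 1)) :
    mink (push y v) (push y w) = hypMetric y v w := by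
  have h := confFactor_mul_norm_sq hy
  simp only [mink_apply, push_apply, inner_smul_left, inner_smul_right, inner_add_left,
    inner_add_right, RCLike.conj_to_real, real_inner_self_eq_norm_sq, real_inner_comm y v,
    hypMetric]
  linear_combination confFactor y ^ 3 * inner ℝ y v * inner ℝ y w * h

/-- Thus `Y_a` is the Killing field generated by the boost in the direction `a`. -/
theorem push_fieldY {y : Euc (n + 1)} (hy : ‖y‖ < 1) (a : Euc (n + 1)) :
    push y (fieldY a y) = boost a (hypPos y) := by
  have h := confFactor_mul_norm_sq hy
  simp only [push_apply, fieldY, boost, hypPos, LinearMap.coe_mk, AddHom.coe_mk, inner_sub_right,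
    inner_smul_right, inner_smul_left, RCLike.conj_to_real, real_inner_self_eq_norm_sq]
  refine Prod.ext ?_ ?_
  · simp only
    match_scalars
    · linear_combination (1 / 2 : ℝ) * h
    · linear_combination (-(1 / 2 : ℝ) * confFactor y * inner ℝ y a) * h
  · simp only
    linear_combination (-(1 / 2 : ℝ) * confFactor y * inner ℝ y a) * h

theorem euclRadius_sq {R : ℝ} : euclRadius R ^ 2 = (Real.cosh R - 1) / (Real.cosh R + 1) := by
  rw [euclRadius, Real.sq_sqrt]
  have := Real.one_le_cosh R
  exact div_nonneg (by linarith) (by linarith)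

theorem two_div_one_sub_euclRadius_sq (R : ℝ) :
    2 / (1 - euclRadius R ^ 2) = Real.cosh R + 1 := by
  have := Real.one_le_cosh R
  have h1 : Real.cosh R + 1 ≠ 0 := by linarith
  rw [euclRadius_sq]
  field_simp
  ring

theorem euclRadius_lt_one (R : ℝ) : euclRadius R < 1 := by
  have := Real.one_le_cosh R
  have h1 : euclRadius R ^ 2 < 1 := by
    rw [euclRadius_sq, div_lt_one (by linarith)]; linarith
  nlinarith [Real.sqrt_nonneg ((Real.cosh R - 1) / (Real.cosh R + 1))]

theorem euclRadius_pos {R : ℝ} (hR : 0 < R) : 0 < euclRadius R := by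
  have := Real.one_lt_cosh.mpr hR.ne'
  exact Real.sqrt_pos.mpr (div_pos (by linarith) (by linarith))

/-- The first two terms are the projection of the constant vector `(a, 0)` to the tangent space of
the hyperboloid. Subtracting `cosh R` times the boost makes the height component vanish where the
height is `cosh R`, so `X_a` is tangent to `∂B_R`. -/
theorem push_fieldX {y : Euc (n + 1)} (hy : ‖y‖ < 1) (R : ℝ) (a : Euc (n + 1)) :
    push y (fieldX R a y) =
      (a, 0) + funV a y • hypPos y - Real.cosh R • boost a (hypPos y) := by
  have h := confFactor_mul_norm_sq hy
  have hr := two_div_one_sub_euclRadius_sq R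
  have hr2 : (Real.cosh R + 1) * euclRadius R ^ 2 = Real.cosh R - 1 := by
    have := Real.one_le_cosh R
    have h1 : Real.cosh R + 1 ≠ 0 := by linarith
    rw [euclRadius_sq]; field_simp
  have hV : funV a y = confFactor y * inner ℝ y a := by rw [funV, confFactor]; ring
  rw [hV]
  simp only [push_apply, fieldX, boost, hypPos, LinearMap.coe_mk, AddHom.coe_mk, inner_sub_right,
    inner_smul_right, inner_smul_left, RCLike.conj_to_real, real_inner_self_eq_norm_sq, hr]
  set l := confFactor y
  set s := ‖y‖ ^ 2
  set C := Real.cosh R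
  refine Prod.ext ?_ ?_
  · simp only [Prod.fst_add, Prod.fst_sub, Prod.smul_fst]
    match_scalars
    · linear_combination ((C + 1) / 2 * l * inner ℝ y a) * h - l ^ 2 / 2 * inner ℝ y a * hr2
    · linear_combination (-(C + 1) / 2) * h - l / 2 * hr2
  · simp only [Prod.snd_add, Prod.snd_sub, Prod.smul_snd, smul_eq_mul]
    linear_combination ((C + 1) / 2 * l * inner ℝ y a) * h - l ^ 2 / 2 * inner ℝ y a * hr2

theorem hypPos_snd_of_norm_eq {y : Euc (n + 1)} {R : ℝ} (hy : ‖y‖ = euclRadius R) :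
    (hypPos y).2 = Real.cosh R := by
  simp only [hypPos, confFactor, hy, two_div_one_sub_euclRadius_sq]
  ring

/-- The height of the pushed vector is its hyperbolic product with `sphereNormal y` times
`confFactor y * ‖y‖`, and this factor equals `sinh R` on the sphere. So a constant contact angle
means a normal of constant height. -/
theorem push_snd_of_contact_angle {y : Euc (n + 1)} {R θ : ℝ} (hR : 0 < R)
    (hy : ‖y‖ = euclRadius R) {v : Euc (n + 1)}
    (hv : hypMetric y v (sphereNormal y) = Real.cos (Real.pi - θ)) :
    (push y v).2 = -(Real.sinh R * Real.cos θ) := by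
  have hr := euclRadius_pos hR
  have hl : confFactor y = Real.cosh R + 1 := by
    rw [confFactor, hy, two_div_one_sub_euclRadius_sq]
  have hl0 : 0 < confFactor y := confFactor_pos (hy ▸ euclRadius_lt_one R)
  have hs : confFactor y * euclRadius R = Real.sinh R := by
    have h1 : (confFactor y * euclRadius R) ^ 2 = Real.sinh R ^ 2 := by
      have := Real.one_le_cosh R
      have h1 : Real.cosh R + 1 ≠ 0 := by linarith
      rw [mul_pow, euclRadius_sq, hl, Real.sinh_sq]; field_simp; ring
    exact (pow_left_inj₀ (by positivity) (Real.sinh_pos_iff.mpr hR).le two_ne_zero).mp h1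
  rw [Real.cos_pi_sub] at hv
  simp only [hypMetric, sphereNormal, inner_smul_right, hy, real_inner_comm y v] at hv
  rw [push_apply]
  simp only
  have h2 : confFactor y ^ 2 * inner ℝ y v = -Real.cos θ * (confFactor y * euclRadius R) := by
    rw [← hv]; field_simp
  rw [h2, hs]; ring

variable {E : Type*} [NormedAddCommGroup E] [NormedSpace ℝ E] {X ν : E → Euc (n + 1)}
  {X' ν' : E →L[ℝ] Euc (n + 1)} {s : Set E} {y : E}

theorem hasFDerivWithinAt_confFactor (hX : HasFDerivWithinAt X X' s y) (hy : ‖X y‖ < 1) :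
    HasFDerivWithinAt (fun y => confFactor (X y))
      (confFactor (X y) ^ 2 • (innerSL ℝ (X y)).comp X') s y := by
  have h0 := (one_sub_norm_sq_pos hy).ne'
  have h1 := ((hasDerivAt_inv h0).comp_hasFDerivWithinAt y (hX.norm_sq.const_sub 1)).const_mul 2
  refine (h1.congr_fderiv ?_).congr_of_eventuallyEq
    (Filter.Eventually.of_forall fun z => by simp [confFactor, div_eq_mul_inv])
    (by simp [confFactor, div_eq_mul_inv])
  ext v
  simp [confFactor]
  field_simp

theorem hasFDerivWithinAt_hypPos (hX : HasFDerivWithinAt X X' s y) (hy : ‖X y‖ < 1) :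
    HasFDerivWithinAt (fun y => hypPos (X y)) ((push (X y)).comp X') s y := by
  have hl := hasFDerivWithinAt_confFactor hX hy
  refine ((hl.smul hX).prodMk (hl.sub_const 1)).congr_fderiv ?_
  ext v
  · simp [push_apply]
  · simp [push_apply]

/-- The Gauss formula of the hyperboloid: the flat derivative of a tangent field is its Levi-Civita
derivative plus a multiple of the position. -/
theorem hasFDerivWithinAt_push (hX : HasFDerivWithinAt X X' s y) (hν : HasFDerivWithinAt ν ν' s y)
    (hy : ‖X y‖ < 1) :
    ∃ L : E →L[ℝ] Mink n, HasFDerivWithinAt (fun y => push (X y) (ν y)) L s y ∧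
      ∀ v, L v = push (X y) (ν' v + christoffel (X y) (X' v) (ν y)) +
        hypMetric (X y) (X' v) (ν y) • hypPos (X y) := by
  have hl := hasFDerivWithinAt_confFactor hX hy
  have h1 := (hl.pow 2).mul (hX.inner ℝ hν)
  refine ⟨_, ((hl.smul hν).add (h1.smul hX)).prodMk h1, fun v => ?_⟩
  have h := confFactor_mul_norm_sq hy
  simp only [push_apply, christoffel, hypPos, hypMetric]
  refine Prod.ext ?_ ?_
  · simp [inner_add_right, inner_sub_right, inner_smul_right]
    match_scalars
    · ring
    · ring
    · ring
    · linear_combination (confFactor (X y) ^ 2 * inner ℝ (X' v) (ν y)) * h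
  · simp [inner_add_right, inner_sub_right, inner_smul_right]
    linear_combination (confFactor (X y) ^ 2 * inner ℝ (X' v) (ν y)) * h

end Model

end HypBall

/-! ### Differentials in charts. -/

namespace HypBall

/-- The standard basis of `ℝⁿ`. -/
noncomputable def stdVec {n : ℕ} (i : Fin n) : Euc n := EuclideanSpace.single i (1 : ℝ)

theorem eq_sum_stdVec {n : ℕ} (v : Euc n) : v = ∑ i, v i • stdVec i := by
  ext j
  simp [stdVec, Pi.single_apply]

section Charts

variable {n : ℕ} [NeZero n] {M : Type*} [TopologicalSpace M]
  [ChartedSpace (EuclideanHalfSpace n) M]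

/-- The Jacobian of the inverse of the chart around `q`. -/
noncomputable def chartJac (q : M) (y : Euc n) : Euc n →L[ℝ] Euc n :=
  mfderivWithin 𝓘(ℝ, Euc n) (𝓡∂ n) (extChartAt (𝓡∂ n) q).symm (Set.range (𝓡∂ n)) y

/-- The matrix of `chartJac`. -/
noncomputable def jacMatrix (q : M) (y : Euc n) : Matrix (Fin n) (Fin n) ℝ :=
  Matrix.of fun l k => chartJac q y (stdVec k) l

theorem map_chartJac_stdVec {W : Type*} [AddCommGroup W] [Module ℝ W] (T : Euc n →ₗ[ℝ] W) (q : M)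
    (y : Euc n) (k : Fin n) :
    T (chartJac q y (stdVec k)) = ∑ l, jacMatrix q y l k • T (stdVec l) := by
  conv_lhs => rw [eq_sum_stdVec (chartJac q y (stdVec k))]
  simp only [map_sum, map_smul, jacMatrix, Matrix.of_apply]

theorem target_mem_nhdsWithin {q : M} {y : Euc n} (hy : y ∈ (extChartAt (𝓡∂ n) q).target) :
    (extChartAt (𝓡∂ n) q).target ∈ nhdsWithin y (Set.range (𝓡∂ n)) :=
  extChartAt_target_mem_nhdsWithin_of_mem hy

theorem mem_range_of_mem_target {q : M} {y : Euc n} (hy : y ∈ (extChartAt (𝓡∂ n) q).target) :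
    y ∈ Set.range (𝓡∂ n) := extChartAt_target_subset_range q hy

variable [IsManifold (𝓡∂ n) ∞ M]

theorem chartJac_isInvertible {q : M} {y : Euc n} (hy : y ∈ (extChartAt (𝓡∂ n) q).target) :
    (chartJac q y).IsInvertible := by
  have : IsManifold (𝓡∂ n) 1 M := .of_le (n := ∞) (by simp)
  exact isInvertible_mfderivWithin_extChartAt_symm hy

theorem uniqueDiffOn_range : UniqueDiffOn ℝ (Set.range (𝓡∂ n)) := (𝓡∂ n).uniqueDiffOn

variable {W : Type*} [NormedAddCommGroup W] [NormedSpace ℝ W]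

/-- The differential of a map to a normed space. -/
noncomputable def tanMap (F : M → W) (p : M) : Euc n →L[ℝ] W :=
  mfderiv (𝓡∂ n) 𝓘(ℝ, W) F p

/-- A map in the chart around `q`. -/
noncomputable def inChart (F : M → W) (q : M) : Euc n → W := F ∘ (extChartAt (𝓡∂ n) q).symm

theorem contDiffWithinAt_inChart {F : M → W} (hF : ContMDiff (𝓡∂ n) 𝓘(ℝ, W) ∞ F) {q : M} {y : Euc n}
    (hy : y ∈ (extChartAt (𝓡∂ n) q).target) :
    ContDiffWithinAt ℝ ∞ (inChart F q) (Set.range (𝓡∂ n)) y := by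
  have h1 : ContMDiffOn 𝓘(ℝ, Euc n) 𝓘(ℝ, W) ∞ (inChart F q) (extChartAt (𝓡∂ n) q).target :=
    hF.comp_contMDiffOn (contMDiffOn_extChartAt_symm q)
  have h2 := contMDiffOn_iff_contDiffOn.mp h1 y hy
  exact h2.mono_of_mem_nhdsWithin (target_mem_nhdsWithin hy)

theorem hasFDerivWithinAt_inChart {F : M → W} (hF : ContMDiff (𝓡∂ n) 𝓘(ℝ, W) ∞ F) {q : M} {y : Euc n}
    (hy : y ∈ (extChartAt (𝓡∂ n) q).target) :
    HasFDerivWithinAt (inChart F q) ((tanMap F ((extChartAt (𝓡∂ n) q).symm y)).comp (chartJac q y))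
      (Set.range (𝓡∂ n)) y := by
  have : IsManifold (𝓡∂ n) 1 M := .of_le (n := ∞) (by simp)
  have h1 := (contDiffWithinAt_inChart hF hy).differentiableWithinAt (by simp)
  have h2 : fderivWithin ℝ (inChart F q) (Set.range (𝓡∂ n)) y =
      (tanMap F ((extChartAt (𝓡∂ n) q).symm y)).comp (chartJac q y) := by
    rw [← mfderivWithin_eq_fderivWithin]
    exact mfderiv_comp_mfderivWithin y (hF.mdifferentiableAt (by simp))
      (mdifferentiableWithinAt_extChartAt_symm hy)
      (uniqueDiffOn_range y (mem_range_of_mem_target hy)).uniqueMDiffWithinAt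
  rw [← h2]
  exact h1.hasFDerivWithinAt

theorem fderivWithin_inChart {F : M → W} (hF : ContMDiff (𝓡∂ n) 𝓘(ℝ, W) ∞ F) {q : M} {y : Euc n}
    (hy : y ∈ (extChartAt (𝓡∂ n) q).target) :
    fderivWithin ℝ (inChart F q) (Set.range (𝓡∂ n)) y =
      (tanMap F ((extChartAt (𝓡∂ n) q).symm y)).comp (chartJac q y) :=
  (hasFDerivWithinAt_inChart hF hy).fderivWithin (uniqueDiffOn_range y (mem_range_of_mem_target hy))

theorem contDiffWithinAt_fderivWithin_inChart {F : M → W} (hF : ContMDiff (𝓡∂ n) 𝓘(ℝ, W) ∞ F)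
    {q : M} {y : Euc n} (hy : y ∈ (extChartAt (𝓡∂ n) q).target) :
    ContDiffWithinAt ℝ ∞ (fderivWithin ℝ (inChart F q) (Set.range (𝓡∂ n)))
      (Set.range (𝓡∂ n)) y :=
  (contDiffWithinAt_inChart hF hy).fderivWithin_right uniqueDiffOn_range (by simp)
    (mem_range_of_mem_target hy)

end Charts

end HypBall

namespace HypBall

/-! ### Coordinate-free first order data. -/

section Tangent

variable {n : ℕ}

/-- The coordinate free form of `IsFrame`: `T` is the differential of the position and `U` the
differential of the normal. -/
structure IsTangentData (T U : Euc n →L[ℝ] Mink n) (Φ N : Mink n) : Prop where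
  pos_pos : mink Φ Φ = -1
  nor_nor : mink N N = 1
  pos_nor : mink Φ N = 0
  frame_pos : ∀ v, mink (T v) Φ = 0
  frame_nor : ∀ v, mink (T v) N = 0
  deriv_pos : ∀ v, mink (U v) Φ = 0
  deriv_nor : ∀ v, mink (U v) N = 0
  symm : ∀ v w, mink (U v) (T w) = mink (U w) (T v)
  pos : ∀ v, v ≠ 0 → 0 < mink (T v) (T v)

theorem IsTangentData.isFrame {T U : Euc n →L[ℝ] Mink n} {Φ N : Mink n}
    (h : IsTangentData T U Φ N) :
    IsFrame (fun i => T (stdVec i)) (fun i => U (stdVec i)) Φ N where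
  pos_pos := h.pos_pos
  nor_nor := h.nor_nor
  pos_nor := h.pos_nor
  frame_pos _ := h.frame_pos _
  frame_nor _ := h.frame_nor _
  deriv_pos _ := h.deriv_pos _
  deriv_nor _ := h.deriv_nor _
  symm _ _ := h.symm _ _
  posDef := by
    refine Matrix.PosDef.of_dotProduct_mulVec_pos (by ext i j; exact mink_comm _ _) fun c hc => ?_
    have h1 := h.pos (WithLp.toLp 2 c) (by simpa using hc)
    rw [eq_sum_stdVec (WithLp.toLp 2 c)] at h1
    simp only [map_sum, map_smul, LinearMap.sum_apply, LinearMap.smul_apply, smul_eq_mul] at h1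
    rw [← gram_symm]
    simpa only [Matrix.transpose_apply, dotProduct, Matrix.mulVec, gram, Finset.mul_sum, Matrix.of_apply, Pi.star_apply,
      star_trivial, mul_comm (mink _ _)] using h1

theorem IsTangentData.comp {T U : Euc n →L[ℝ] Mink n} {Φ N : Mink n}
    (h : IsTangentData T U Φ N) {J : Euc n →L[ℝ] Euc n} (hJ : J.IsInvertible) :
    IsTangentData (T.comp J) (U.comp J) Φ N where
  pos_pos := h.pos_pos
  nor_nor := h.nor_nor
  pos_nor := h.pos_nor
  frame_pos _ := h.frame_pos _
  frame_nor _ := h.frame_nor _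
  deriv_pos _ := h.deriv_pos _
  deriv_nor _ := h.deriv_nor _
  symm _ _ := h.symm _ _
  pos _ hv := h.pos _ fun h0 => hv (hJ.bijective.1 (h0.trans (map_zero J).symm))

theorem hasFDerivWithinAt_mink {E : Type*} [NormedAddCommGroup E] [NormedSpace ℝ E]
    {f g : E → Mink n} {f' g' : E →L[ℝ] Mink n} {s : Set E} {y : E}
    (hf : HasFDerivWithinAt f f' s y) (hg : HasFDerivWithinAt g g' s y) :
    ∃ L : E →L[ℝ] ℝ, HasFDerivWithinAt (fun y => mink (f y) (g y)) L s y ∧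
      ∀ v, L v = mink (f' v) (g y) + mink (f y) (g' v) := by
  refine ⟨_, (hf.fst.inner ℝ hg.fst).sub (hf.snd.mul hg.snd), fun v => ?_⟩
  simp [mink_apply]
  ring

theorem mink_fderivWithin_eq_zero {E : Type*} [NormedAddCommGroup E] [NormedSpace ℝ E]
    {f g : E → Mink n} {f' g' : E →L[ℝ] Mink n} {s : Set E} {y : E}
    (hf : HasFDerivWithinAt f f' s y) (hg : HasFDerivWithinAt g g' s y)
    (hs : UniqueDiffWithinAt ℝ s y) (hy : y ∈ s) {c : ℝ}
    (hc : ∀ᶠ z in nhdsWithin y s, mink (f z) (g z) = c) (v : E) :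
    mink (f' v) (g y) + mink (f y) (g' v) = 0 := by
  obtain ⟨L, hL, hv⟩ := hasFDerivWithinAt_mink hf hg
  have h0 : HasFDerivWithinAt (fun y => mink (f y) (g y)) (0 : E →L[ℝ] ℝ) s y :=
    (hasFDerivWithinAt_const c y s).congr_of_eventuallyEq hc (hc.self_of_nhdsWithin hy)
  rw [← hv, hs.eq hL h0]
  rfl

end Tangent

/-! ### The capillary immersion in the hyperboloid. -/

section Capillary

variable {n : ℕ} [NeZero n] {M : Type*} [TopologicalSpace M]
  [ChartedSpace (EuclideanHalfSpace n) M]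

/-- The immersion, seen in the hyperboloid. -/
noncomputable def posMap (x : M → Euc (n + 1)) (p : M) : Mink n := hypPos (x p)

/-- The unit normal, seen in the hyperboloid. -/
noncomputable def norMap (x ν : M → Euc (n + 1)) (p : M) : Mink n := push (x p) (ν p)

namespace IsCapillaryImmersion

variable {R θ : ℝ} {x ν : M → Euc (n + 1)}

theorem norm_lt_one (hx : IsCapillaryImmersion R θ x ν) (p : M) : ‖x p‖ < 1 := by
  rcases (𝓡∂ n).isInteriorPoint_or_isBoundaryPoint p with h | h
  · exact (hx.map_interior p h).trans (euclRadius_lt_one R)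
  · exact (hx.map_boundary p h).trans_lt (euclRadius_lt_one R)

theorem contMDiff_confFactor (hx : IsCapillaryImmersion R θ x ν) :
    ContMDiff (𝓡∂ n) 𝓘(ℝ, ℝ) ∞ fun p => confFactor (x p) := by
  intro p
  have h : ContDiffAt ℝ ∞ (confFactor : Euc (n + 1) → ℝ) (x p) :=
    contDiffAt_const.div (contDiffAt_const.sub (contDiffAt_id.norm_sq ℝ))
      (one_sub_norm_sq_pos (hx.norm_lt_one p)).ne'
  exact h.contMDiffAt.comp p (hx.smooth p)

theorem contMDiff_posMap (hx : IsCapillaryImmersion R θ x ν) :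
    ContMDiff (𝓡∂ n) 𝓘(ℝ, Mink n) ∞ (posMap x) := by
  have h1 := hx.contMDiff_confFactor
  exact (h1.smul hx.smooth).prodMk_space (h1.sub contMDiff_const)

theorem contMDiff_norMap (hx : IsCapillaryImmersion R θ x ν) :
    ContMDiff (𝓡∂ n) 𝓘(ℝ, Mink n) ∞ (norMap x ν) := by
  have h1 := hx.contMDiff_confFactor
  have h2 : ContMDiff (𝓡∂ n) 𝓘(ℝ, ℝ) ∞ fun p => (inner ℝ (x p) (ν p) : ℝ) := fun p =>
    (contDiff_inner (𝕜 := ℝ) (E := Euc (n + 1))).contDiffAt.contMDiffAt.comp p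
      ((hx.smooth p).prodMk_space (hx.smooth_normal p))
  have h3 := (h1.pow 2).mul h2
  exact ((h1.smul hx.smooth_normal).add (h3.smul hx.smooth)).prodMk_space h3

variable [IsManifold (𝓡∂ n) ∞ M]

theorem tanMap_posMap (hx : IsCapillaryImmersion R θ x ν) (p : M) (v : Euc n) :
    tanMap (posMap x) p v = push (x p) (tanMap x p v) := by
  have hy := mem_extChartAt_target (I := 𝓡∂ n) p
  set y := extChartAt (𝓡∂ n) p p
  have hp : (extChartAt (𝓡∂ n) p).symm y = p := extChartAt_to_inv p
  have hu := uniqueDiffOn_range y (mem_range_of_mem_target hy)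
  have h1 := hasFDerivWithinAt_inChart hx.contMDiff_posMap hy
  have h2 := hasFDerivWithinAt_hypPos (hasFDerivWithinAt_inChart hx.smooth hy)
    (hx.norm_lt_one ((extChartAt (𝓡∂ n) p).symm y))
  obtain ⟨w, rfl⟩ := (chartJac_isInvertible hy).bijective.2 v
  have h3 := DFunLike.congr_fun (hu.eq h1 h2) w
  simp only [ContinuousLinearMap.comp_apply, inChart, Function.comp_apply, hp] at h3
  exact h3

/-- The position term of the Gauss formula is `g(dx v, ν)`, which is zero because `ν` is normal. The
comparison is made in the chart at `p`, whose Jacobian is surjective. -/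
theorem tanMap_norMap (hx : IsCapillaryImmersion R θ x ν) (p : M) (v : Euc n) :
    tanMap (norMap x ν) p v = push (x p) (covDeriv x ν p v) := by
  have hy := mem_extChartAt_target (I := 𝓡∂ n) p
  set y := extChartAt (𝓡∂ n) p p
  have hp : (extChartAt (𝓡∂ n) p).symm y = p := extChartAt_to_inv p
  have hu := uniqueDiffOn_range y (mem_range_of_mem_target hy)
  have h1 := hasFDerivWithinAt_inChart hx.contMDiff_norMap hy
  obtain ⟨L, h2, hL⟩ := hasFDerivWithinAt_push (hasFDerivWithinAt_inChart hx.smooth hy)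
    (hasFDerivWithinAt_inChart hx.smooth_normal hy)
    (hx.norm_lt_one ((extChartAt (𝓡∂ n) p).symm y))
  obtain ⟨w, rfl⟩ := (chartJac_isInvertible hy).bijective.2 v
  have h3 := (DFunLike.congr_fun (hu.eq h1 h2) w).trans (hL w)
  simp only [ContinuousLinearMap.comp_apply, inChart, Function.comp_apply, hp] at h3
  have h4 := hx.normal_orthogonal p (chartJac p y w)
  have h5 : hypMetric (x p) (tanMap x p (chartJac p y w)) (ν p) = 0 := by
    rw [hypMetric, real_inner_comm]; exact h4
  rw [h5, zero_smul, add_zero] at h3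
  exact h3

theorem isTangentData (hx : IsCapillaryImmersion R θ x ν) (p : M) :
    IsTangentData (tanMap (posMap x) p) (tanMap (norMap x ν) p) (posMap x p) (norMap x ν p) := by
  have frame_nor : ∀ p v, mink (tanMap (posMap x) p v) (norMap x ν p) = 0 := fun p v => by
    rw [hx.tanMap_posMap, mink_comm, norMap, mink_push_push (hx.norm_lt_one p)]
    exact hx.normal_orthogonal p v
  have nor_nor : ∀ p, mink (norMap x ν p) (norMap x ν p) = 1 := fun p => by
    rw [norMap, mink_push_push (hx.norm_lt_one p), hx.normal_unit]
  have hy := mem_extChartAt_target (I := 𝓡∂ n) p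
  set y := extChartAt (𝓡∂ n) p p
  have hp : (extChartAt (𝓡∂ n) p).symm y = p := extChartAt_to_inv p
  have hyr := mem_range_of_mem_target hy
  have hu := uniqueDiffOn_range y hyr
  have hN := hasFDerivWithinAt_inChart hx.contMDiff_norMap hy
  have hsurj := (chartJac_isInvertible hy).bijective.2
  refine
  { pos_pos := mink_hypPos (hx.norm_lt_one p)
    nor_nor := nor_nor p
    pos_nor := by rw [mink_comm]; exact mink_push_hypPos (hx.norm_lt_one p) _
    frame_pos := fun v => by
      rw [hx.tanMap_posMap]; exact mink_push_hypPos (hx.norm_lt_one p) _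
    frame_nor := frame_nor p
    deriv_pos := fun v => by
      rw [hx.tanMap_norMap]; exact mink_push_hypPos (hx.norm_lt_one p) _
    deriv_nor := fun v => ?_
    symm := fun v w => ?_
    pos := fun v hv => ?_ }
  · obtain ⟨v, rfl⟩ := hsurj v
    have h1 := mink_fderivWithin_eq_zero hN hN hu hyr (c := 1)
      (Filter.Eventually.of_forall fun z => nor_nor _) v
    simp only [ContinuousLinearMap.comp_apply, inChart, Function.comp_apply, hp] at h1
    rw [mink_comm (norMap x ν p)] at h1
    linarith
  · obtain ⟨v, rfl⟩ := hsurj v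
    obtain ⟨w, rfl⟩ := hsurj w
    have hD := ((contDiffWithinAt_fderivWithin_inChart hx.contMDiff_posMap hy).differentiableWithinAt
      (by simp)).hasFDerivWithinAt
    -- Differentiating `⟨N, dΦ w⟩ = 0` in the direction `v` expresses the second fundamental form
    -- through the second derivative of `Φ`; its symmetry is then that of second derivatives.
    have key : ∀ v w : Euc n, mink (tanMap (norMap x ν) p (chartJac p y v))
        (tanMap (posMap x) p (chartJac p y w)) = -mink (norMap x ν p)
          (fderivWithin ℝ (fderivWithin ℝ (inChart (posMap x) p) (Set.range (𝓡∂ n)))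
            (Set.range (𝓡∂ n)) y v w) := by
      intro v w
      have hDw := hD.clm_apply (hasFDerivWithinAt_const w y (Set.range (𝓡∂ n)))
      have hev : ∀ᶠ z in nhdsWithin y (Set.range (𝓡∂ n)), mink (inChart (norMap x ν) p z)
          (fderivWithin ℝ (inChart (posMap x) p) (Set.range (𝓡∂ n)) z w) = 0 := by
        filter_upwards [target_mem_nhdsWithin hy] with z hz
        rw [fderivWithin_inChart hx.contMDiff_posMap hz, mink_comm]
        exact frame_nor _ _
      have h1 := mink_fderivWithin_eq_zero hN hDw hu hyr hev v
      rw [fderivWithin_inChart hx.contMDiff_posMap hy] at h1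
      simp only [ContinuousLinearMap.comp_apply, inChart, Function.comp_apply, hp,
        _root_.add_apply, ContinuousLinearMap.flip_apply,
        _root_.zero_apply, map_zero, zero_add] at h1
      exact eq_neg_of_add_eq_zero_left h1
    rw [key, key]
    have hsymm := (contDiffWithinAt_inChart hx.contMDiff_posMap hy).isSymmSndFDerivWithinAt
      (by rw [minSmoothness_of_isRCLikeNormedField]; exact WithTop.coe_le_coe.mpr le_top) uniqueDiffOn_range ((𝓡∂ n).range_subset_closure_interior hyr) hyr
    rw [hsymm v w]
  · rw [hx.tanMap_posMap, mink_push_push (hx.norm_lt_one p), hypMetric]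
    have h1 : tanMap x p v ≠ 0 := fun h0 => hv (hx.immersion p (h0.trans (map_zero _).symm))
    have h2 := confFactor_pos (hx.norm_lt_one p)
    have h3 := real_inner_self_pos.mpr h1
    positivity

theorem weingarten_eq (hx : IsCapillaryImmersion R θ x ν) (p : M) : weingarten x ν p =
    shape (fun i => tanMap (posMap x) p (stdVec i)) (fun i => tanMap (norMap x ν) p (stdVec i)) := by
  have h1 : (Matrix.of fun i j => inducedMetric x p (coordVec p i) (coordVec p j)) =
      gram fun i => tanMap (posMap x) p (stdVec i) := by
    ext i j
    simp only [gram, Matrix.of_apply, hx.tanMap_posMap, mink_push_push (hx.norm_lt_one p)]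
    rfl
  have h2 : (Matrix.of fun i j => secondFundamentalForm x ν p (coordVec p i) (coordVec p j)) =
      Matrix.of fun i j => mink (tanMap (norMap x ν) p (stdVec i))
        (tanMap (posMap x) p (stdVec j)) := by
    ext i j
    simp only [Matrix.of_apply, hx.tanMap_posMap, hx.tanMap_norMap,
      mink_push_push (hx.norm_lt_one p)]
    rfl
  rw [weingarten, h1, h2, shape]

end IsCapillaryImmersion

end Capillary

end HypBall

namespace HypBall

/-! ### The flux in coordinates and its divergence. -/

section Balance

variable {n : ℕ}

/-- The image of the standard basis under a linear map. -/
noncomputable def stdImage {W : Type*} [NormedAddCommGroup W] [NormedSpace ℝ W]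
    (T : Euc n →L[ℝ] W) (i : Fin n) : W := T (stdVec i)

/-- The divergence of the Newton transform of the test field `z`, multiplied by a cut-off function
with value `c` and differential `g`, as a multiple of the coordinate volume. -/
noncomputable def balanceNum (t : ℝ) (T U : Euc n →L[ℝ] Mink n) (Φ N z : Mink n) (c : ℝ)
    (g : Euc n →L[ℝ] ℝ) : ℝ :=
  c * (mink z Φ * slotSum Φ N (stdImage (T + t • U)) (stdImage T) -
    mink z N * slotSum Φ N (stdImage (T + t • U)) (stdImage U)) +
  slotSum Φ N (stdImage (T + t • U)) (fun i => stdImage g i • z)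

/-- This turns the algebraic identity `IsFrame.divergence` into a statement about derivatives;
`hsymm` supplies the Codazzi symmetry, and the cut-off `f` adds the term with `f'`. -/
theorem hasFDerivAt_flux {f : Euc n → ℝ} {Φ N z : Euc n → Mink n} {w : Euc n → Fin n → Mink n}
    {f' : Euc n →L[ℝ] ℝ} {Φ' N' z' : Euc n →L[ℝ] Mink n} {w' : Fin n → Euc n →L[ℝ] Mink n}
    {y : Euc n} {t : ℝ} (hf : HasFDerivAt f f' y) (hΦ : HasFDerivAt Φ Φ' y)
    (hN : HasFDerivAt N N' y) (hz : HasFDerivAt z z' y)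
    (hw : ∀ j, HasFDerivAt (fun y => w y j) (w' j) y)
    (hframe : IsFrame (stdImage Φ') (stdImage N') (Φ y) (N y))
    (hwy : w y = fun j => stdImage Φ' j + t • stdImage N' j)
    (hsymm : ∀ i j, w' j (stdVec i) = w' i (stdVec j)) :
    ∃ G : Fin n → Euc n →L[ℝ] ℝ,
      (∀ i, HasFDerivAt (fun y => f y * tanDet (Φ y) (N y) (Function.update (w y) i (z y)))
        (G i) y) ∧
      ∑ i, G i (stdVec i) = f y * (slotSum (Φ y) (N y) (w y) (stdImage z') +
        (mink (z y) (Φ y) * slotSum (Φ y) (N y) (w y) (stdImage Φ') -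
          mink (z y) (N y) * slotSum (Φ y) (N y) (w y) (stdImage N'))) +
        slotSum (Φ y) (N y) (w y) (fun i => stdImage f' i • z y) := by
  let r : Fin n → Fin n ⊕ Fin 2 → Euc n → Mink n := fun i k y =>
    rows (Function.update (w y) i (z y)) (Φ y) (N y) k
  let r' : Fin n → Fin n ⊕ Fin 2 → Euc n →L[ℝ] Mink n := fun i =>
    Sum.elim (Function.update w' i z') ![Φ', N']
  have hr : ∀ i k, HasFDerivAt (r i k) (r' i k) y := by
    intro i k
    rcases k with j | k
    · by_cases hj : j = i
      · subst hj
        have e1 : r j (Sum.inl j) = z := funext fun y => Function.update_self ..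
        have e2 : r' j (Sum.inl j) = z' := Function.update_self ..
        rw [e1, e2]
        exact hz
      · have e1 : r i (Sum.inl j) = fun y => w y j := funext fun y => Function.update_of_ne hj ..
        have e2 : r' i (Sum.inl j) = w' j := Function.update_of_ne hj ..
        rw [e1, e2]
        exact hw j
    · fin_cases k
      · exact hΦ
      · exact hN
  choose D' hD' hDv using fun i => hasFDerivAt_minkDet (hr i)
  refine ⟨fun i => f y • D' i + (minkDet n fun k => r i k y) • f', fun i => hf.mul (hD' i), ?_⟩
  have hrv : ∀ i k, r' i k (stdVec i) = rows (Function.update (fun j => w' j (stdVec i)) i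
      (stdImage z' i)) (stdImage Φ' i) (stdImage N' i) k := by
    intro i k
    rcases k with j | k
    · by_cases hj : j = i
      · subst hj
        rw [rows_inl, Function.update_self, stdImage]
        exact congrArg (fun L : Euc n →L[ℝ] Mink n => L (stdVec j)) (Function.update_self ..)
      · rw [rows_inl, Function.update_of_ne hj]
        exact congrArg (fun L : Euc n →L[ℝ] Mink n => L (stdVec i)) (Function.update_of_ne hj ..)
    · fin_cases k <;> rfl
  change ∑ i, (f y * D' i (stdVec i) + (minkDet n fun k => r i k y) * f' (stdVec i)) = _
  rw [Finset.sum_add_distrib, ← Finset.mul_sum]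
  simp only [hDv, hrv]
  have hdiv := hframe.divergence t (z y) (stdImage z') (fun i j => w' j (stdVec i)) hsymm
  rw [← hwy] at hdiv
  refine congrArg₂ (· + ·) (congrArg _ (hdiv.trans (add_sub_assoc _ _ _))) ?_
  refine Finset.sum_congr rfl fun i _ => ?_
  rw [AlternatingMap.map_update_smul, smul_eq_mul, mul_comm]
  rfl

variable [NeZero n] {M : Type*} [TopologicalSpace M] [ChartedSpace (EuclideanHalfSpace n) M]

theorem stdImage_comp_chartJac {W : Type*} [NormedAddCommGroup W] [NormedSpace ℝ W]
    (T : Euc n →L[ℝ] W) (q : M) (y : Euc n) :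
    stdImage (T.comp (chartJac q y)) = fun k => ∑ l, jacMatrix q y l k • stdImage T l := by
  ext1 k
  exact map_chartJac_stdVec T.toLinearMap q y k

theorem tanDet_comp_chartJac (T : Euc n →L[ℝ] Mink n) (Φ N : Mink n) (q : M) (y : Euc n) :
    tanDet Φ N (stdImage (T.comp (chartJac q y))) =
      (jacMatrix q y).det * tanDet Φ N (stdImage T) := by
  rw [stdImage_comp_chartJac, alternating_matrix]

/-- The divergence transforms like a density, by the same factor as `tanDet`. The quotient `balance`
is therefore a function on `M`, independent of the chart. -/
theorem balanceNum_comp_chartJac (t : ℝ) (T U : Euc n →L[ℝ] Mink n) (Φ N z : Mink n) (c : ℝ)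
    (g : Euc n →L[ℝ] ℝ) (q : M) (y : Euc n) :
    balanceNum t (T.comp (chartJac q y)) (U.comp (chartJac q y)) Φ N z c (g.comp (chartJac q y)) =
      (jacMatrix q y).det * balanceNum t T U Φ N z c g := by
  have h1 : T.comp (chartJac q y) + t • U.comp (chartJac q y) =
      (T + t • U).comp (chartJac q y) := by ext1 v; simp
  have h2 : (fun i => stdImage (g.comp (chartJac q y)) i • z) =
      stdImage ((g.smulRight z).comp (chartJac q y)) := by ext1 i; simp [stdImage]
  have h3 : (fun i => stdImage g i • z) = stdImage (g.smulRight z) := by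
    ext1 i; simp [stdImage]
  simp only [balanceNum, h1, h2, h3]
  simp only [stdImage_comp_chartJac, slotSum_matrix]
  ring

end Balance

/-! ### Continuity of the determinant expressions. -/

section Continuity

variable {n : ℕ} {E : Type*} [TopologicalSpace E] {s : Set E} {y : E}

theorem continuousWithinAt_tanDet {Φ N : E → Mink n} {w : E → Fin n → Mink n}
    (hΦ : ContinuousWithinAt Φ s y) (hN : ContinuousWithinAt N s y)
    (hw : ∀ i, ContinuousWithinAt (fun z => w z i) s y) :
    ContinuousWithinAt (fun z => tanDet (Φ z) (N z) (w z)) s y := by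
  have h1 : ContinuousWithinAt (fun z => rows (w z) (Φ z) (N z)) s y :=
    continuousWithinAt_pi.mpr fun k => by
      rcases k with i | k
      · exact hw i
      · fin_cases k
        · exact hΦ
        · exact hN
  exact (minkDet n).cont.continuousAt.comp_continuousWithinAt h1

theorem continuousWithinAt_slotSum {Φ N : E → Mink n} {w u : E → Fin n → Mink n}
    (hΦ : ContinuousWithinAt Φ s y) (hN : ContinuousWithinAt N s y)
    (hw : ∀ i, ContinuousWithinAt (fun z => w z i) s y)
    (hu : ∀ i, ContinuousWithinAt (fun z => u z i) s y) :
    ContinuousWithinAt (fun z => slotSum (Φ z) (N z) (w z) (u z)) s y := by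
  refine tendsto_finsetSum _ fun i _ => continuousWithinAt_tanDet hΦ hN fun j => ?_
  by_cases hj : j = i
  · subst hj; simpa using hu j
  · simpa [hj] using hw j

theorem continuousWithinAt_mink {f g : E → Mink n} (hf : ContinuousWithinAt f s y)
    (hg : ContinuousWithinAt g s y) : ContinuousWithinAt (fun z => mink (f z) (g z)) s y :=
  (Filter.Tendsto.inner (𝕜 := ℝ) hf.fst hg.fst).sub (hf.snd.mul hg.snd)

theorem continuousWithinAt_stdImage {W : Type*} [NormedAddCommGroup W] [NormedSpace ℝ W]
    {T : E → Euc n →L[ℝ] W} (hT : ContinuousWithinAt T s y) (i : Fin n) :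
    ContinuousWithinAt (fun z => stdImage (T z) i) s y :=
  hT.clm_apply continuousWithinAt_const

theorem continuousWithinAt_balanceNum (t : ℝ) {T U : E → Euc n →L[ℝ] Mink n} {Φ N z : E → Mink n}
    {c : E → ℝ} {g : E → Euc n →L[ℝ] ℝ} (hT : ContinuousWithinAt T s y)
    (hU : ContinuousWithinAt U s y) (hΦ : ContinuousWithinAt Φ s y) (hN : ContinuousWithinAt N s y)
    (hz : ContinuousWithinAt z s y) (hc : ContinuousWithinAt c s y)
    (hg : ContinuousWithinAt g s y) :
    ContinuousWithinAt
      (fun v => balanceNum t (T v) (U v) (Φ v) (N v) (z v) (c v) (g v)) s y := by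
  have hw := hT.add (hU.const_smul t)
  have hw' := continuousWithinAt_stdImage hw
  have h1 := (continuousWithinAt_mink hz hΦ).mul
    (continuousWithinAt_slotSum hΦ hN hw' (continuousWithinAt_stdImage hT))
  have h2 := (continuousWithinAt_mink hz hN).mul
    (continuousWithinAt_slotSum hΦ hN hw' (continuousWithinAt_stdImage hU))
  exact (hc.mul (h1.sub h2)).add
    (continuousWithinAt_slotSum hΦ hN hw' fun i => (continuousWithinAt_stdImage hg i).smul hz)

end Continuity

/-! ### Flux and divergence along the immersion. -/

section Capillary

variable {n : ℕ} [NeZero n] {M : Type*} [TopologicalSpace M]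
  [ChartedSpace (EuclideanHalfSpace n) M]

/-- The test field along the immersion. -/
noncomputable def testMap (R θ : ℝ) (a : Euc (n + 1)) (x ν : M → Euc (n + 1)) (p : M) : Mink n :=
  testField (Real.cosh R) (Real.sinh R * Real.cos θ) a (posMap x p) (norMap x ν p)

/-- The differential of a map in the chart around `q`. -/
noncomputable def chartDeriv {W : Type*} [NormedAddCommGroup W] [NormedSpace ℝ W] (F : M → W)
    (q : M) (y : Euc n) : Euc n →L[ℝ] W :=
  fderivWithin ℝ (inChart F q) (Set.range (𝓡∂ n)) y

/-- The coefficients of the Newton transform of the test field in the chart around `q`. -/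
noncomputable def fluxField (t R θ : ℝ) (a : Euc (n + 1)) (x ν : M → Euc (n + 1)) (f : M → ℝ)
    (q : M) (y : Euc n) (i : Fin n) : ℝ :=
  inChart f q y * tanDet (inChart (posMap x) q y) (inChart (norMap x ν) q y)
    (Function.update (stdImage (chartDeriv (posMap x) q y + t • chartDeriv (norMap x ν) q y)) i
      (inChart (testMap R θ a x ν) q y))

/-- The divergence of `fluxField` in the chart around `q`. -/
noncomputable def fluxDiv (t R θ : ℝ) (a : Euc (n + 1)) (x ν : M → Euc (n + 1)) (f : M → ℝ)
    (q : M) (y : Euc n) : ℝ :=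
  balanceNum t (chartDeriv (posMap x) q y) (chartDeriv (norMap x ν) q y) (inChart (posMap x) q y)
    (inChart (norMap x ν) q y) (inChart (testMap R θ a x ν) q y) (inChart f q y) (chartDeriv f q y)

/-- The Jacobian of the immersion in the chart around `q`, with a sign. -/
noncomputable def chartDet (x ν : M → Euc (n + 1)) (q : M) (y : Euc n) : ℝ :=
  tanDet (inChart (posMap x) q y) (inChart (norMap x ν) q y)
    (stdImage (chartDeriv (posMap x) q y))

/-- The divergence of the Newton transform of the test field multiplied by `f`. -/
noncomputable def balance (t R θ : ℝ) (a : Euc (n + 1)) (x ν : M → Euc (n + 1)) (f : M → ℝ)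
    (p : M) : ℝ :=
  balanceNum t (tanMap (posMap x) p) (tanMap (norMap x ν) p) (posMap x p) (norMap x ν p)
    (testMap R θ a x ν p) (f p) (tanMap f p) /
  tanDet (posMap x p) (norMap x ν p) (stdImage (tanMap (posMap x) p))

theorem IsCapillaryImmersion.contMDiff_testMap {R θ : ℝ} {x ν : M → Euc (n + 1)}
    (hx : IsCapillaryImmersion R θ x ν) (a : Euc (n + 1)) :
    ContMDiff (𝓡∂ n) 𝓘(ℝ, Mink n) ∞ (testMap R θ a x ν) := by
  let B : Mink n →L[ℝ] Mink n := LinearMap.toContinuousLinearMap (boost a)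
  have h1 : ContDiff ℝ ∞ fun u : Mink n × Mink n =>
      ((a, 0) : Mink n) - B (Real.cosh R • u.1 + (Real.sinh R * Real.cos θ) • u.2) := by
    fun_prop
  have h2 : testMap R θ a x ν = (fun u : Mink n × Mink n => ((a, 0) : Mink n) -
      B (Real.cosh R • u.1 + (Real.sinh R * Real.cos θ) • u.2)) ∘
      fun p => (posMap x p, norMap x ν p) := by
    funext p
    rw [testMap, testField, Function.comp_apply, LinearMap.coe_toContinuousLinearMap']
  rw [h2]
  exact h1.contMDiff.comp (hx.contMDiff_posMap.prodMk_space hx.contMDiff_norMap)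

variable [IsManifold (𝓡∂ n) ∞ M]

theorem continuousWithinAt_inChart {W : Type*} [NormedAddCommGroup W] [NormedSpace ℝ W] {F : M → W}
    (hF : ContMDiff (𝓡∂ n) 𝓘(ℝ, W) ∞ F) {q : M} {y : Euc n}
    (hy : y ∈ (extChartAt (𝓡∂ n) q).target) :
    ContinuousWithinAt (inChart F q) (Set.range (𝓡∂ n)) y :=
  (contDiffWithinAt_inChart hF hy).continuousWithinAt

theorem continuousWithinAt_chartDeriv {W : Type*} [NormedAddCommGroup W] [NormedSpace ℝ W]
    {F : M → W} (hF : ContMDiff (𝓡∂ n) 𝓘(ℝ, W) ∞ F) {q : M} {y : Euc n}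
    (hy : y ∈ (extChartAt (𝓡∂ n) q).target) :
    ContinuousWithinAt (chartDeriv F q) (Set.range (𝓡∂ n)) y :=
  (contDiffWithinAt_fderivWithin_inChart hF hy).continuousWithinAt

namespace IsCapillaryImmersion

variable {R θ : ℝ} {x ν : M → Euc (n + 1)}

theorem isTangentData_chart (hx : IsCapillaryImmersion R θ x ν)
    {q : M} {y : Euc n} (hy : y ∈ (extChartAt (𝓡∂ n) q).target) :
    IsTangentData (chartDeriv (posMap x) q y) (chartDeriv (norMap x ν) q y)
      (inChart (posMap x) q y) (inChart (norMap x ν) q y) := by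
  rw [chartDeriv, chartDeriv, fderivWithin_inChart hx.contMDiff_posMap hy,
    fderivWithin_inChart hx.contMDiff_norMap hy]
  exact (hx.isTangentData _).comp (chartJac_isInvertible hy)

theorem chartDet_ne_zero (hx : IsCapillaryImmersion R θ x ν)
    {q : M} {y : Euc n} (hy : y ∈ (extChartAt (𝓡∂ n) q).target) :
    chartDet x ν q y ≠ 0 := (hx.isTangentData_chart hy).isFrame.det_ne_zero

theorem continuousWithinAt_chartDet (hx : IsCapillaryImmersion R θ x ν) {q : M} {y : Euc n}
    (hy : y ∈ (extChartAt (𝓡∂ n) q).target) :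
    ContinuousWithinAt (chartDet x ν q) (Set.range (𝓡∂ n)) y :=
  continuousWithinAt_tanDet (continuousWithinAt_inChart hx.contMDiff_posMap hy)
    (continuousWithinAt_inChart hx.contMDiff_norMap hy)
    (continuousWithinAt_stdImage (continuousWithinAt_chartDeriv hx.contMDiff_posMap hy))

theorem continuousWithinAt_fluxDiv (hx : IsCapillaryImmersion R θ x ν)
    (t : ℝ) (a : Euc (n + 1)) {f : M → ℝ}
    (hf : ContMDiff (𝓡∂ n) 𝓘(ℝ, ℝ) ∞ f) {q : M} {y : Euc n}
    (hy : y ∈ (extChartAt (𝓡∂ n) q).target) :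
    ContinuousWithinAt (fluxDiv t R θ a x ν f q) (Set.range (𝓡∂ n)) y :=
  continuousWithinAt_balanceNum t (continuousWithinAt_chartDeriv hx.contMDiff_posMap hy)
    (continuousWithinAt_chartDeriv hx.contMDiff_norMap hy)
    (continuousWithinAt_inChart hx.contMDiff_posMap hy)
    (continuousWithinAt_inChart hx.contMDiff_norMap hy)
    (continuousWithinAt_inChart (hx.contMDiff_testMap a) hy) (continuousWithinAt_inChart hf hy)
    (continuousWithinAt_chartDeriv hf hy)

theorem continuousWithinAt_fluxField (hx : IsCapillaryImmersion R θ x ν)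
    (t : ℝ) (a : Euc (n + 1)) {f : M → ℝ}
    (hf : ContMDiff (𝓡∂ n) 𝓘(ℝ, ℝ) ∞ f) {q : M} {y : Euc n}
    (hy : y ∈ (extChartAt (𝓡∂ n) q).target) (i : Fin n) :
    ContinuousWithinAt (fun y => fluxField t R θ a x ν f q y i) (Set.range (𝓡∂ n)) y := by
  refine (continuousWithinAt_inChart hf hy).mul (continuousWithinAt_tanDet
    (continuousWithinAt_inChart hx.contMDiff_posMap hy)
    (continuousWithinAt_inChart hx.contMDiff_norMap hy) fun j => ?_)
  by_cases hj : j = i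
  · subst hj; simpa using continuousWithinAt_inChart (hx.contMDiff_testMap a) hy
  · simpa [hj] using continuousWithinAt_stdImage
      ((continuousWithinAt_chartDeriv hx.contMDiff_posMap hy).add
        ((continuousWithinAt_chartDeriv hx.contMDiff_norMap hy).const_smul t)) j

theorem fluxDiv_eq (hx : IsCapillaryImmersion R θ x ν) (t : ℝ) (a : Euc (n + 1)) {f : M → ℝ}
    (hf : ContMDiff (𝓡∂ n) 𝓘(ℝ, ℝ) ∞ f) {q : M} {y : Euc n}
    (hy : y ∈ (extChartAt (𝓡∂ n) q).target) :
    fluxDiv t R θ a x ν f q y =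
      chartDet x ν q y * balance t R θ a x ν f ((extChartAt (𝓡∂ n) q).symm y) := by
  have h0 := hx.chartDet_ne_zero hy
  have h1 : chartDet x ν q y = (jacMatrix q y).det *
      tanDet (inChart (posMap x) q y) (inChart (norMap x ν) q y)
        (stdImage (tanMap (posMap x) ((extChartAt (𝓡∂ n) q).symm y))) := by
    rw [chartDet, chartDeriv, fderivWithin_inChart hx.contMDiff_posMap hy, tanDet_comp_chartJac]
  have h2 := right_ne_zero_of_mul (h1 ▸ h0)
  rw [fluxDiv, chartDeriv, chartDeriv, chartDeriv, fderivWithin_inChart hx.contMDiff_posMap hy,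
    fderivWithin_inChart hx.contMDiff_norMap hy, fderivWithin_inChart hf hy,
    balanceNum_comp_chartJac, h1, mul_assoc]
  congr 1
  rw [balance, mul_div_assoc']
  exact (mul_div_cancel_left₀ _ h2).symm

theorem hasFDerivAt_fluxField (hx : IsCapillaryImmersion R θ x ν)
    (t : ℝ) (a : Euc (n + 1)) {f : M → ℝ}
    (hf : ContMDiff (𝓡∂ n) 𝓘(ℝ, ℝ) ∞ f) {q : M} {y : Euc n}
    (hy : y ∈ (extChartAt (𝓡∂ n) q).target) (hyi : y ∈ interior (Set.range (𝓡∂ n))) :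
    ∃ G : Fin n → Euc n →L[ℝ] ℝ,
      (∀ i, HasFDerivAt (fun y => fluxField t R θ a x ν f q y i) (G i) y) ∧
      ∑ i, G i (stdVec i) = fluxDiv t R θ a x ν f q y := by
  have hS : Set.range (𝓡∂ n) ∈ nhds y := mem_interior_iff_mem_nhds.mp hyi
  have hyr := mem_range_of_mem_target hy
  have hframe := (hx.isTangentData_chart hy).isFrame
  have hder : ∀ {W : Type} [NormedAddCommGroup W] [NormedSpace ℝ W] {F : M → W},
      ContMDiff (𝓡∂ n) 𝓘(ℝ, W) ∞ F → HasFDerivAt (inChart F q) (chartDeriv F q y) y :=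
    fun hF => ((contDiffWithinAt_inChart hF hy).differentiableWithinAt
      (by simp)).hasFDerivWithinAt.hasFDerivAt hS
  have hder2 : ∀ {F : M → Mink n}, ContMDiff (𝓡∂ n) 𝓘(ℝ, Mink n) ∞ F →
      HasFDerivAt (chartDeriv F q)
        (fderivWithin ℝ (chartDeriv F q) (Set.range (𝓡∂ n)) y) y := fun hF =>
    ((contDiffWithinAt_fderivWithin_inChart hF hy).differentiableWithinAt
      (by simp)).hasFDerivWithinAt.hasFDerivAt hS
  have hsymm : ∀ {F : M → Mink n}, ContMDiff (𝓡∂ n) 𝓘(ℝ, Mink n) ∞ F → ∀ v w,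
      fderivWithin ℝ (chartDeriv F q) (Set.range (𝓡∂ n)) y v w =
        fderivWithin ℝ (chartDeriv F q) (Set.range (𝓡∂ n)) y w v := fun hF =>
    (contDiffWithinAt_inChart hF hy).isSymmSndFDerivWithinAt
      (by rw [minSmoothness_of_isRCLikeNormedField]; exact WithTop.coe_le_coe.mpr le_top)
      uniqueDiffOn_range ((𝓡∂ n).range_subset_closure_interior hyr) hyr
  have hΦ := hder hx.contMDiff_posMap
  have hN := hder hx.contMDiff_norMap
  set D2Φ := fderivWithin ℝ (chartDeriv (posMap x) q) (Set.range (𝓡∂ n)) y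
  set D2N := fderivWithin ℝ (chartDeriv (norMap x ν) q) (Set.range (𝓡∂ n)) y
  set w : Euc n → Fin n → Mink n :=
    fun y => stdImage (chartDeriv (posMap x) q y + t • chartDeriv (norMap x ν) q y)
  have hw : ∀ j, HasFDerivAt (fun y => w y j) ((D2Φ + t • D2N).flip (stdVec j)) y := by
    intro j
    refine (((hder2 hx.contMDiff_posMap).add ((hder2 hx.contMDiff_norMap).const_smul t)).clm_apply
      (hasFDerivAt_const (stdVec j) y)).congr_fderiv ?_
    ext1 v
    exact (add_eq_right.mpr ((chartDeriv (posMap x) q y + t • chartDeriv (norMap x ν) q y).map_zero))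
  let C := Real.cosh R
  let c := Real.sinh R * Real.cos θ
  let B : Mink n →L[ℝ] Mink n := LinearMap.toContinuousLinearMap (boost a)
  let z' : Euc n →L[ℝ] Mink n :=
    -(B.comp (C • chartDeriv (posMap x) q y + c • chartDeriv (norMap x ν) q y))
  have hz : HasFDerivAt (inChart (testMap R θ a x ν) q) z' y := by
    refine ((B.hasFDerivAt.comp y ((hΦ.const_smul C).add (hN.const_smul c))).const_sub
      ((a, 0) : Mink n)).congr_fderiv ?_
    rfl
  -- The derivative of the test field is `-L (C dΦ + c dN)` with `L` skew, so `sum_skew_frame` and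
  -- `sum_skew_deriv` apply to its two parts.
  have hsk : slotSum (inChart (posMap x) q y) (inChart (norMap x ν) q y) (w y) (stdImage z') = 0 := by
    have h1 := hframe.sum_skew_frame t (boost a) (mink_boost a)
    have h2 := hframe.sum_skew_deriv t (boost a) (mink_boost a)
    have h3 : ∀ i, stdImage z' i = (-C) • boost a (stdImage (chartDeriv (posMap x) q y) i) +
        (-c) • boost a (stdImage (chartDeriv (norMap x ν) q y) i) := by
      intro i
      change -(boost a (C • chartDeriv (posMap x) q y (stdVec i) +
        c • chartDeriv (norMap x ν) q y (stdVec i))) = _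
      rw [map_add, map_smul, map_smul, neg_add, neg_smul, neg_smul]
      rfl
    have h4 : ∀ i, tanDet (inChart (posMap x) q y) (inChart (norMap x ν) q y)
        (Function.update (w y) i (stdImage z' i)) =
        (-C) * tanDet (inChart (posMap x) q y) (inChart (norMap x ν) q y)
          (Function.update (w y) i (boost a (stdImage (chartDeriv (posMap x) q y) i))) +
        (-c) * tanDet (inChart (posMap x) q y) (inChart (norMap x ν) q y)
          (Function.update (w y) i (boost a (stdImage (chartDeriv (norMap x ν) q y) i))) := by
      intro i
      rw [h3, AlternatingMap.map_update_add, AlternatingMap.map_update_smul,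
        AlternatingMap.map_update_smul, smul_eq_mul, smul_eq_mul]
    rw [slotSum, Finset.sum_congr rfl fun i _ => h4 i, Finset.sum_add_distrib, ← Finset.mul_sum,
      ← Finset.mul_sum]
    refine (congrArg₂ (fun a b => (-C) * a + (-c) * b) h1 h2).trans ?_
    rw [mul_zero, mul_zero, add_zero]
  obtain ⟨G, hG, hGs⟩ := hasFDerivAt_flux (t := t) (hder hf) hΦ hN hz hw hframe rfl fun i j => by
    change D2Φ (stdVec i) (stdVec j) + t • D2N (stdVec i) (stdVec j) =
      D2Φ (stdVec j) (stdVec i) + t • D2N (stdVec j) (stdVec i)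
    rw [hsymm hx.contMDiff_posMap, hsymm hx.contMDiff_norMap]
  refine ⟨G, hG, hGs.trans ?_⟩
  rw [hsk, zero_add]
  rfl

end IsCapillaryImmersion

end Capillary

end HypBall

namespace HypBall

/-! ### The divergence theorem on a half space. -/

section HalfSpace

/-- The divergence theorem on a half space, for a compactly supported field which is tangent to the
boundary. -/
theorem setIntegral_divergence_halfSpace_eq_zero {m : ℕ} {F : Euc (m + 1) → Fin (m + 1) → ℝ}
    {dv : Euc (m + 1) → ℝ} {K : Set (Euc (m + 1))} (hK : IsCompact K)
    (hF0 : ∀ y ∉ K, ∀ i, F y i = 0) (hdv0 : ∀ y ∉ K, dv y = 0)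
    (hFc : ∀ i, ContinuousOn (fun y => F y i) {y | 0 ≤ y 0})
    (hdc : ContinuousOn dv {y | 0 ≤ y 0})
    (hd : ∀ y, 0 < y 0 → ∃ G : Fin (m + 1) → Euc (m + 1) →L[ℝ] ℝ,
      (∀ i, HasFDerivAt (fun y => F y i) (G i) y) ∧ ∑ i, G i (stdVec i) = dv y)
    (hb : ∀ y, y 0 = 0 → F y 0 = 0) : ∫ y in {y : Euc (m + 1) | 0 ≤ y 0}, dv y = 0 := by
  obtain ⟨C, hC0, hC⟩ := hK.isBounded.exists_pos_norm_lt
  have hKC : ∀ y : Euc (m + 1), ∀ i, C ≤ |y i| → y ∉ K := fun y i h hy =>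
    absurd (h.trans (PiLp.norm_apply_le y i)) (not_le.mpr (hC y hy))
  let l : (Fin (m + 1) → ℝ) ≃L[ℝ] Euc (m + 1) :=
    (PiLp.continuousLinearEquiv 2 ℝ fun _ : Fin (m + 1) => ℝ).symm
  have hl : ∀ v i, l v i = v i := fun v i => rfl
  -- The box `[0, C] × [-C, C]^m` contains the part of `K` in the half space, and every face except
  -- the one in `y 0 = 0` lies outside `K`. There the field is zero by `hF0`; on the remaining face
  -- `hb` kills the normal component.
  let a : Fin (m + 1) → ℝ := fun i => if i = 0 then 0 else -C
  let b : Fin (m + 1) → ℝ := fun _ => C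
  have ha0 : a 0 = 0 := if_pos rfl
  have ha : ∀ i ≠ 0, a i = -C := fun i hi => if_neg hi
  have hab : a ≤ b := by
    intro i
    by_cases hi : i = 0
    · subst hi; rw [ha0]; exact hC0.le
    · rw [ha i hi]; exact (neg_lt_self hC0).le
  have hIcc : Set.Icc a b ⊆ l ⁻¹' {y | 0 ≤ y 0} := fun v hv => by
    have := hv.1 0
    rw [ha0] at this
    exact this
  have h1 : ∫ y in {y : Euc (m + 1) | 0 ≤ y 0}, dv y = ∫ v in Set.Icc a b, dv (l v) := by
    have hmp := (PiLp.volume_preserving_toLp (Fin (m + 1))).setIntegral_preimage_emb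
      (MeasurableEquiv.toLp 2 (Fin (m + 1) → ℝ)).measurableEmbedding dv {y | 0 ≤ y 0}
    rw [← hmp]
    refine setIntegral_eq_of_subset_of_forall_sdiff_eq_zero ?_ hIcc fun v hv => ?_
    · have : IsClosed {v : Fin (m + 1) → ℝ | 0 ≤ v 0} :=
        isClosed_le continuous_const (continuous_apply 0)
      exact this.measurableSet
    · by_contra h0
      have hvK : l v ∈ K := by
        by_contra h
        exact h0 (hdv0 _ h)
      have hlt : ∀ i, |v i| < C := fun i => by
        by_contra h
        exact hKC _ i (not_lt.mp h) hvK
      refine hv.2 ⟨fun i => ?_, fun i => (abs_lt.mp (hlt i)).2.le⟩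
      by_cases hi : i = 0
      · subst hi; rw [ha0]; exact hv.1
      · rw [ha i hi]; exact (abs_lt.mp (hlt i)).1.le
  choose! G hG hGs using hd
  have hpos : ∀ v ∈ (Set.pi Set.univ fun i => Set.Ioo (a i) (b i)), 0 < l v 0 := fun v hv => by
    have := (hv 0 (Set.mem_univ _)).1
    rw [ha0] at this
    exact this
  have hstd : ∀ i, l (Pi.single i 1) = stdVec i := fun i => rfl
  have hsum : ∀ v ∈ (Set.pi Set.univ fun i => Set.Ioo (a i) (b i)),
      ∑ i, ((G (l v) i).comp l.toContinuousLinearMap) (Pi.single i 1) = dv (l v) := fun v hv => by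
    simp only [ContinuousLinearMap.comp_apply]
    exact hGs _ (hpos v hv)
  have hae : (Set.pi Set.univ fun i => Set.Ioo (a i) (b i)) =ᵐ[volume] Set.Icc a b := by
    exact Measure.univ_pi_Ioo_ae_eq_Icc
  have hmeas : MeasurableSet (Set.pi Set.univ fun i => Set.Ioo (a i) (b i)) :=
    MeasurableSet.univ_pi fun i => measurableSet_Ioo
  have hint : IntegrableOn (fun v => dv (l v)) (Set.Icc a b) :=
    ((hdc.comp l.continuous.continuousOn hIcc).integrableOn_compact isCompact_Icc)
  have h2 := integral_divergence_of_hasFDerivAt_off_countable' a b hab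
    (fun i v => F (l v) i) (fun i v => (G (l v) i).comp l.toContinuousLinearMap) ∅
    Set.countable_empty (fun i => (hFc i).comp l.continuous.continuousOn hIcc)
    (fun v hv i => (hG _ (hpos v hv.1) i).comp v l.hasFDerivAt)
    (((hint.congr_set_ae hae).congr_fun (fun v hv => (hsum v hv).symm) hmeas).congr_set_ae hae.symm)
  rw [h1, ← setIntegral_congr_set hae, ← setIntegral_congr_fun hmeas hsum,
    setIntegral_congr_set hae, h2]
  refine Finset.sum_eq_zero fun i _ => ?_
  have hfront : ∀ v, F (l (i.insertNth (b i) v)) i = 0 := fun v =>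
    hF0 _ (hKC _ i (by rw [hl, Fin.insertNth_apply_same]; exact le_abs_self C)) i
  have hback : ∀ v, F (l (i.insertNth (a i) v)) i = 0 := fun v => by
    by_cases hi : i = 0
    · subst hi
      exact hb _ (by rw [hl, Fin.insertNth_apply_same, ha0])
    · exact hF0 _ (hKC _ i (by
        rw [hl, Fin.insertNth_apply_same, ha i hi, abs_neg]; exact le_abs_self C)) i
  simp only [hfront, hback, integral_zero, sub_zero]

end HalfSpace

/-! ### The flux at the boundary. -/

section Capillary

variable {n : ℕ} [NeZero n] {M : Type*} [TopologicalSpace M]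
  [ChartedSpace (EuclideanHalfSpace n) M] [IsManifold (𝓡∂ n) ∞ M]

theorem mem_boundary_of_apply_zero {q : M} {y : Euc n} (hy : y ∈ (extChartAt (𝓡∂ n) q).target)
    (h0 : y 0 = 0) : (extChartAt (𝓡∂ n) q).symm y ∈ (𝓡∂ n).boundary M := by
  have hs : (extChartAt (𝓡∂ n) q).symm y ∈ (chartAt (EuclideanHalfSpace n) q).source := by
    rw [← extChartAt_source (𝓡∂ n)]
    exact (extChartAt (𝓡∂ n) q).map_target hy
  refine ((𝓡∂ n).isBoundaryPoint_iff_of_mem_atlas (n := ∞) (by simp)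
    (chart_mem_atlas (EuclideanHalfSpace n) q) hs).mpr ?_
  change extChartAt (𝓡∂ n) q _ ∈ frontier (extChartAt (𝓡∂ n) q).target
  rw [(extChartAt (𝓡∂ n) q).right_inv hy]
  refine ⟨subset_closure hy, fun hi => ?_⟩
  have := interior_mono (extChartAt_target_subset_range q) hi
  rw [interior_range_modelWithCornersEuclideanHalfSpace] at this
  exact this.ne' h0

/-- For `j ≠ 0` the line through `y` in the direction `j` stays in the boundary hyperplane of the
chart, and there the height of `F` is constant. It is applied to both position and normal. -/
theorem snd_chartDeriv_eq_zero {F : M → Mink n} (hF : ContMDiff (𝓡∂ n) 𝓘(ℝ, Mink n) ∞ F) {c : ℝ}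
    (hc : ∀ p ∈ (𝓡∂ n).boundary M, (F p).2 = c) {q : M} {y : Euc n}
    (hy : y ∈ (extChartAt (𝓡∂ n) q).target) (h0 : y 0 = 0) {j : Fin n} (hj : j ≠ 0) :
    (stdImage (chartDeriv F q y) j).2 = 0 := by
  have hD : HasFDerivWithinAt (inChart F q) (chartDeriv F q y) (Set.range (𝓡∂ n)) y :=
    ((contDiffWithinAt_inChart hF hy).differentiableWithinAt (by simp)).hasFDerivWithinAt
  have hline : HasDerivAt (fun s : ℝ => y + s • stdVec j) (stdVec j) 0 := by
    simpa using ((hasDerivAt_id (0 : ℝ)).smul_const (stdVec j)).const_add y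
  have hl0 : ∀ s : ℝ, (y + s • stdVec j) 0 = 0 := fun s => by
    simp [stdVec, h0, hj.symm]
  have hmem : ∀ s : ℝ, y + s • stdVec j ∈ Set.range (𝓡∂ n) := fun s => by
    rw [range_modelWithCornersEuclideanHalfSpace]
    exact (hl0 s).ge
  have hy0 : y + (0 : ℝ) • stdVec j = y := by simp
  have h1 : HasDerivAt (fun s : ℝ => inChart F q (y + s • stdVec j))
      (chartDeriv F q y (stdVec j)) 0 := by
    rw [← hasDerivWithinAt_univ]
    exact hD.comp_hasDerivWithinAt_of_eq (0 : ℝ) hline.hasDerivWithinAt (fun s _ => hmem s)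
      hy0.symm
  have h2 : ∀ᶠ s : ℝ in nhds 0, (inChart F q (y + s • stdVec j)).2 = c := by
    have h3 : Filter.Tendsto (fun s : ℝ => y + s • stdVec j) (nhds 0)
        (nhdsWithin y (Set.range (𝓡∂ n))) := by
      refine tendsto_nhdsWithin_iff.mpr ⟨?_, Filter.Eventually.of_forall hmem⟩
      have := hline.continuousAt.tendsto
      rwa [hy0] at this
    filter_upwards [h3 (target_mem_nhdsWithin hy)] with s hs
    exact hc _ (mem_boundary_of_apply_zero hs (hl0 s))
  have h4 : HasDerivAt (fun s : ℝ => (inChart F q (y + s • stdVec j)).2) 0 0 :=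
    (hasDerivAt_const (0 : ℝ) c).congr_of_eventuallyEq h2
  have h5 : HasDerivAt (fun s : ℝ => (inChart F q (y + s • stdVec j)).2)
      (chartDeriv F q y (stdVec j)).2 0 :=
    (ContinuousLinearMap.snd ℝ (Euc (n + 1)) ℝ).hasFDerivAt.comp_hasDerivAt (0 : ℝ) h1
  exact h5.unique h4

/-- The flux is tangent to the boundary. -/
theorem IsCapillaryImmersion.fluxField_eq_zero {R θ : ℝ} {x ν : M → Euc (n + 1)}
    (hx : IsCapillaryImmersion R θ x ν) (hR : 0 < R) (hθ₀ : 0 < θ) (hθπ : θ < Real.pi) (t : ℝ)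
    (a : Euc (n + 1)) (f : M → ℝ) {q : M} {y : Euc n} (hy : y ∈ (extChartAt (𝓡∂ n) q).target)
    (h0 : y 0 = 0) : fluxField t R θ a x ν f q y 0 = 0 := by
  have hpos : ∀ p ∈ (𝓡∂ n).boundary M, (posMap x p).2 = Real.cosh R := fun p hp =>
    hypPos_snd_of_norm_eq (hx.map_boundary p hp)
  have hnor : ∀ p ∈ (𝓡∂ n).boundary M, (norMap x ν p).2 = -(Real.sinh R * Real.cos θ) :=
    fun p hp => push_snd_of_contact_angle hR (hx.map_boundary p hp) (hx.contact_angle p hp)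
  have hp := mem_boundary_of_apply_zero hy h0
  have hT := hx.isTangentData_chart hy
  have hsin := Real.sin_pos_of_pos_of_lt_pi hθ₀ hθπ
  -- The gap is `sinh² R sin² θ`, positive because `R > 0` and `0 < θ < π`: the hypersurface meets
  -- the sphere transversally.
  have hc : (Real.sinh R * Real.cos θ) ^ 2 < Real.cosh R ^ 2 - 1 := by
    have h1 := Real.sinh_pos_iff.mpr hR
    have h2 := Real.sin_sq_add_cos_sq θ
    have h3 : 0 < Real.sinh R ^ 2 * Real.sin θ ^ 2 := by positivity
    have h4 : Real.cosh R ^ 2 - 1 = Real.sinh R ^ 2 := by rw [Real.sinh_sq]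
    rw [h4]
    nlinarith
  rw [fluxField]
  refine mul_eq_zero_of_right _ (tanDet_testField_eq_zero a hc hT.pos_pos hT.nor_nor hT.pos_nor
    (hpos _ hp) (hnor _ hp) 0 (fun j => ?_) (fun j => ?_) fun j hj => ?_)
  · exact hT.isFrame.variation_pos t j
  · exact hT.isFrame.variation_nor t j
  · have h1 := snd_chartDeriv_eq_zero hx.contMDiff_posMap hpos hy h0 hj
    have h2 := snd_chartDeriv_eq_zero hx.contMDiff_norMap hnor hy h0 hj
    change (stdImage (chartDeriv (posMap x) q y) j).2 +
      t * (stdImage (chartDeriv (norMap x ν) q y) j).2 = 0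
    rw [h1, h2, mul_zero, add_zero]

end Capillary

end HypBall

namespace HypBall

/-! ### The area measure. -/

section Area

variable {n : ℕ}

theorem tanDet_comp (T : Euc n →L[ℝ] Mink n) (L : Euc n →L[ℝ] Euc n) (Φ N : Mink n) :
    tanDet Φ N (stdImage (T.comp L)) = L.det * tanDet Φ N (stdImage T) := by
  have h1 : stdImage (T.comp L) =
      fun k => ∑ l, (Matrix.of fun l k => L (stdVec k) l) l k • stdImage T l := by
    ext1 k
    change T (L (stdVec k)) = _
    conv_lhs => rw [eq_sum_stdVec (L (stdVec k))]
    simp only [map_sum, map_smul, Matrix.of_apply, stdImage]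
  rw [h1, alternating_matrix]
  congr 1
  rw [ContinuousLinearMap.det, ← LinearMap.det_toMatrix (EuclideanSpace.basisFun (Fin n) ℝ).toBasis]
  congr 1

variable [NeZero n] {M : Type*} [TopologicalSpace M]
  [ChartedSpace (EuclideanHalfSpace n) M]

theorem measurableSet_target (q : M) : MeasurableSet (extChartAt (𝓡∂ n) q).target := by
  rw [extChartAt_target]
  exact ((chartAt (EuclideanHalfSpace n) q).open_target.preimage
    (𝓡∂ n).continuous_symm).measurableSet.inter (𝓡∂ n).isClosed_range.measurableSet

section

variable [MeasurableSpace M] [BorelSpace M]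

theorem aemeasurable_chart_symm (q : M) : AEMeasurable (extChartAt (𝓡∂ n) q).symm
    ((volume : Measure (Euc n)).restrict (extChartAt (𝓡∂ n) q).target) :=
  (continuousOn_extChartAt_symm q).aemeasurable (measurableSet_target q)

theorem measurableSet_chart_preimage (q : M) {A : Set M} (hA : MeasurableSet A) :
    MeasurableSet ((extChartAt (𝓡∂ n) q).symm ⁻¹' A ∩ (extChartAt (𝓡∂ n) q).target) := by
  have h1 := (continuousOn_iff_continuous_domRestrict.mp
    (continuousOn_extChartAt_symm (I := 𝓡∂ n) q)).measurable hA
  have h2 := (measurableSet_target q).subtype_image h1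
  convert h2 using 1
  ext y
  simp [and_comm]

theorem chartArea_apply (x : M → Euc (n + 1)) (q : M) {A : Set M} (hA : MeasurableSet A) :
    chartArea x q A = ∫⁻ y in (extChartAt (𝓡∂ n) q).symm ⁻¹' A ∩ (extChartAt (𝓡∂ n) q).target,
      ENNReal.ofReal (chartDensity x q y) := by
  rw [chartArea, Measure.map_apply_of_aemeasurable ((aemeasurable_chart_symm q).mono_ac
    (withDensity_absolutelyContinuous _ _)) hA, withDensity_apply',
    Measure.restrict_restrict' (measurableSet_target q)]

theorem chartArea_eq_zero (x : M → Euc (n + 1)) (q : M) {A : Set M} (hA : MeasurableSet A)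
    (h : Disjoint A (extChartAt (𝓡∂ n) q).source) : chartArea x q A = 0 := by
  rw [chartArea_apply x q hA]
  have : (extChartAt (𝓡∂ n) q).symm ⁻¹' A ∩ (extChartAt (𝓡∂ n) q).target = ∅ :=
    Set.eq_empty_of_forall_notMem fun y hy =>
      Set.disjoint_left.mp h hy.1 ((extChartAt (𝓡∂ n) q).map_target hy.2)
  rw [this]
  simp

end

variable [IsManifold (𝓡∂ n) ∞ M]

/-- The transition map between two charts. -/
noncomputable def transition (q q' : M) : Euc n → Euc n :=
  extChartAt (𝓡∂ n) q ∘ (extChartAt (𝓡∂ n) q').symm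

theorem hasFDerivWithinAt_transition {q q' : M} {y : Euc n}
    (hy : y ∈ (extChartAt (𝓡∂ n) q').target)
    (hyq : (extChartAt (𝓡∂ n) q').symm y ∈ (extChartAt (𝓡∂ n) q).source) :
    HasFDerivWithinAt (transition q q')
      (fderivWithin ℝ (transition q q') (Set.range (𝓡∂ n)) y) (Set.range (𝓡∂ n)) y := by
  have h := contDiffWithinAt_ext_coord_change (I := 𝓡∂ n) (n := ∞) q q' (y := y) (by
    rw [PartialEquiv.trans_source]; exact ⟨hy, hyq⟩)
  exact (h.differentiableWithinAt (by simp)).hasFDerivWithinAt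

theorem chartDeriv_transition {W : Type*} [NormedAddCommGroup W] [NormedSpace ℝ W] {F : M → W}
    (hF : ContMDiff (𝓡∂ n) 𝓘(ℝ, W) ∞ F) {q q' : M} {y : Euc n}
    (hy : y ∈ (extChartAt (𝓡∂ n) q').target)
    (hyq : (extChartAt (𝓡∂ n) q').symm y ∈ (extChartAt (𝓡∂ n) q).source) :
    chartDeriv F q' y = (chartDeriv F q (transition q q' y)).comp
      (fderivWithin ℝ (transition q q') (Set.range (𝓡∂ n)) y) := by
  have hyr := mem_range_of_mem_target hy
  have ht : transition q q' y ∈ (extChartAt (𝓡∂ n) q).target := (extChartAt (𝓡∂ n) q).map_source hyq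
  have h1 : HasFDerivWithinAt (inChart F q) (chartDeriv F q (transition q q' y))
      (Set.range (𝓡∂ n)) (transition q q' y) :=
    ((contDiffWithinAt_inChart hF ht).differentiableWithinAt (by simp)).hasFDerivWithinAt
  have hmap : Set.MapsTo (transition q q') (Set.range (𝓡∂ n)) (Set.range (𝓡∂ n)) := fun z _ =>
    ⟨_, rfl⟩
  have h2 := h1.comp y (hasFDerivWithinAt_transition hy hyq) hmap
  have hcont : ContinuousWithinAt (extChartAt (𝓡∂ n) q').symm (Set.range (𝓡∂ n)) y :=
    (continuousOn_extChartAt_symm q' y hy).mono_of_mem_nhdsWithin (target_mem_nhdsWithin hy)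
  have hev : inChart F q' =ᶠ[nhdsWithin y (Set.range (𝓡∂ n))] inChart F q ∘ transition q q' := by
    filter_upwards [hcont ((isOpen_extChartAt_source q).mem_nhds hyq)] with z hz
    change F _ = F ((extChartAt (𝓡∂ n) q).symm (extChartAt (𝓡∂ n) q _))
    rw [(extChartAt (𝓡∂ n) q).left_inv hz]
  exact (h2.congr_of_eventuallyEq hev (hev.self_of_nhdsWithin hyr)).fderivWithin
    (uniqueDiffOn_range y hyr)

theorem chartDensity_eq {R θ : ℝ} {x ν : M → Euc (n + 1)} (hx : IsCapillaryImmersion R θ x ν) {q : M}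
    {y : Euc n} (hy : y ∈ (extChartAt (𝓡∂ n) q).target) :
    chartDensity x q y = |chartDet x ν q y| := by
  have hT := (hx.isTangentData_chart hy).isFrame
  have h1 : (Matrix.of fun i j : Fin n => hypMetric ((x ∘ (extChartAt (𝓡∂ n) q).symm) y)
      (fderivWithin ℝ (x ∘ (extChartAt (𝓡∂ n) q).symm) (Set.range (𝓡∂ n)) y
        (EuclideanSpace.single i (1 : ℝ)))
      (fderivWithin ℝ (x ∘ (extChartAt (𝓡∂ n) q).symm) (Set.range (𝓡∂ n)) y
        (EuclideanSpace.single j (1 : ℝ)))) = gram (stdImage (chartDeriv (posMap x) q y)) := by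
    ext i j
    have h2 : ∀ i, stdImage (chartDeriv (posMap x) q y) i =
        push (x ((extChartAt (𝓡∂ n) q).symm y))
          (fderivWithin ℝ (inChart x q) (Set.range (𝓡∂ n)) y (stdVec i)) := fun i => by
      rw [stdImage, chartDeriv, fderivWithin_inChart hx.contMDiff_posMap hy,
        fderivWithin_inChart hx.smooth hy]
      exact hx.tanMap_posMap _ _
    rw [gram, Matrix.of_apply, Matrix.of_apply, h2, h2, mink_push_push (hx.norm_lt_one _)]
    rfl
  have h3 : chartDet x ν q y ^ 2 = (gram (stdImage (chartDeriv (posMap x) q y))).det := hT.det_sq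
  rw [chartDensity, h1, ← h3, Real.sqrt_sq_eq_abs]

theorem chartDensity_transition {R θ : ℝ} {x ν : M → Euc (n + 1)}
    (hx : IsCapillaryImmersion R θ x ν) {q q' : M} {y : Euc n}
    (hy : y ∈ (extChartAt (𝓡∂ n) q').target)
    (hyq : (extChartAt (𝓡∂ n) q').symm y ∈ (extChartAt (𝓡∂ n) q).source) :
    chartDensity x q' y = |(fderivWithin ℝ (transition q q') (Set.range (𝓡∂ n)) y).det| *
      chartDensity x q (transition q q' y) := by
  have ht : transition q q' y ∈ (extChartAt (𝓡∂ n) q).target := (extChartAt (𝓡∂ n) q).map_source hyq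
  have hF : ∀ {W : Type} (F : M → W), inChart F q (transition q q' y) = inChart F q' y := fun F => by
    change F ((extChartAt (𝓡∂ n) q).symm (extChartAt (𝓡∂ n) q _)) = F _
    rw [(extChartAt (𝓡∂ n) q).left_inv hyq]
  rw [chartDensity_eq hx hy, chartDensity_eq hx ht, chartDet, chartDet,
    chartDeriv_transition hx.contMDiff_posMap hy hyq, tanDet_comp, abs_mul, hF, hF]

theorem continuousOn_chartDensity {R θ : ℝ} {x ν : M → Euc (n + 1)}
    (hx : IsCapillaryImmersion R θ x ν) (q : M) :
    ContinuousOn (chartDensity x q) (extChartAt (𝓡∂ n) q).target := by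
  have h1 : ContinuousOn (fun y => |chartDet x ν q y|) (extChartAt (𝓡∂ n) q).target :=
    fun y hy => ((hx.continuousWithinAt_chartDet hy).mono
      (extChartAt_target_subset_range q)).abs
  exact h1.congr fun y hy => chartDensity_eq hx hy

variable [MeasurableSpace M] [BorelSpace M]

/-- Change of variables along the transition map, whose Jacobian is the ratio of the two densities
by `chartDensity_transition`. -/
theorem chartArea_congr {R θ : ℝ} {x ν : M → Euc (n + 1)} (hx : IsCapillaryImmersion R θ x ν)
    (q q' : M) {A : Set M} (hA : MeasurableSet A) (hq : A ⊆ (extChartAt (𝓡∂ n) q).source)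
    (hq' : A ⊆ (extChartAt (𝓡∂ n) q').source) : chartArea x q' A = chartArea x q A := by
  rw [chartArea_apply x q hA, chartArea_apply x q' hA]
  set B := (extChartAt (𝓡∂ n) q').symm ⁻¹' A ∩ (extChartAt (𝓡∂ n) q').target with hB
  have hBm : MeasurableSet B := measurableSet_chart_preimage q' hA
  have himg : transition q q' '' B =
      (extChartAt (𝓡∂ n) q).symm ⁻¹' A ∩ (extChartAt (𝓡∂ n) q).target := by
    ext z
    constructor
    · rintro ⟨y, ⟨hy, hyt⟩, rfl⟩
      have hs := hq hy
      refine ⟨?_, (extChartAt (𝓡∂ n) q).map_source hs⟩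
      change (extChartAt (𝓡∂ n) q).symm (extChartAt (𝓡∂ n) q _) ∈ A
      rw [(extChartAt (𝓡∂ n) q).left_inv hs]
      exact hy
    · rintro ⟨hz, hzt⟩
      have hs := hq' hz
      refine ⟨extChartAt (𝓡∂ n) q' ((extChartAt (𝓡∂ n) q).symm z), ⟨?_,
        (extChartAt (𝓡∂ n) q').map_source hs⟩, ?_⟩
      · rw [Set.mem_preimage, (extChartAt (𝓡∂ n) q').left_inv hs]; exact hz
      · change extChartAt (𝓡∂ n) q ((extChartAt (𝓡∂ n) q').symm _) = z
        rw [(extChartAt (𝓡∂ n) q').left_inv hs, (extChartAt (𝓡∂ n) q).right_inv hzt]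
  have hinj : Set.InjOn (transition q q') B := by
    intro y hy z hz h
    have h1 := (extChartAt (𝓡∂ n) q).injOn (hq hy.1) (hq hz.1) h
    exact (extChartAt (𝓡∂ n) q').symm.injOn hy.2 hz.2 h1
  have hder : ∀ y ∈ B, HasFDerivWithinAt (transition q q')
      (fderivWithin ℝ (transition q q') (Set.range (𝓡∂ n)) y) B y := fun y hy =>
    (hasFDerivWithinAt_transition hy.2 (hq hy.1)).mono fun z hz => mem_range_of_mem_target hz.2
  rw [← himg, lintegral_image_eq_lintegral_abs_det_fderiv_mul volume hBm hder hinj]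
  refine setLIntegral_congr_fun hBm fun y hy => ?_
  rw [chartDensity_transition hx hy.2 (hq hy.1), ENNReal.ofReal_mul (abs_nonneg _)]

/-- One inequality is the definition of the supremum. For the other, an explicit measure that equals
`chartArea x q` inside the chart domain is an upper bound of the family. -/
theorem areaMeasure_restrict {R θ : ℝ} {x ν : M → Euc (n + 1)} (hx : IsCapillaryImmersion R θ x ν)
    (q : M) : (areaMeasure x).restrict (extChartAt (𝓡∂ n) q).source = chartArea x q := by
  set U := (extChartAt (𝓡∂ n) q).source with hU
  have hUm : MeasurableSet U := (isOpen_extChartAt_source q).measurableSet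
  have hle : ∀ q', chartArea x q' ≤ areaMeasure x := fun q' => le_iSup (chartArea x) q'
  -- Each `chartArea x q'` is split along `U`: inside, it lives on the overlap of the two domains
  -- and agrees there with `chartArea x q`; outside, it is at most the supremum.
  have hub : areaMeasure x ≤ chartArea x q + (areaMeasure x).restrict Uᶜ := by
    refine iSup_le fun q' => Measure.le_iff.mpr fun s hs => ?_
    set U' := (extChartAt (𝓡∂ n) q').source with hU'
    have hU'm : MeasurableSet U' := (isOpen_extChartAt_source q').measurableSet
    rw [Measure.add_apply, Measure.restrict_apply hs, ← measure_inter_add_sdiff s hUm,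
      ← measure_inter_add_sdiff (s ∩ U) hU'm,
      chartArea_eq_zero x q' (((hs.inter hUm).diff hU'm)) Set.disjoint_sdiff_left, add_zero,
      chartArea_congr hx q q' ((hs.inter hUm).inter hU'm) (fun _ h => h.1.2) (fun _ h => h.2)]
    exact add_le_add (measure_mono fun _ h => h.1.1) (hle q' _)
  refine Measure.ext fun A hA => ?_
  rw [Measure.restrict_apply hA]
  have h1 : chartArea x q A = chartArea x q (A ∩ U) := by
    rw [← measure_inter_add_sdiff A hUm,
      chartArea_eq_zero x q (hA.diff hUm) Set.disjoint_sdiff_left, add_zero]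
  rw [h1]
  refine le_antisymm ?_ (hle q _)
  refine (hub (A ∩ U)).trans_eq ?_
  rw [Measure.add_apply, Measure.restrict_apply (hA.inter hUm)]
  have : A ∩ U ∩ Uᶜ = ∅ := by rw [Set.inter_assoc, Set.inter_compl_self, Set.inter_empty]
  rw [this, measure_empty, add_zero]

/-- Integration in a chart of a continuous function supported there. -/
theorem integrable_and_integral_chart {R θ : ℝ} {x ν : M → Euc (n + 1)}
    (hx : IsCapillaryImmersion R θ x ν) (q : M) {g : M → ℝ} (hg : Continuous g) {K : Set M}
    (hK : IsCompact K) (hKq : K ⊆ (extChartAt (𝓡∂ n) q).source) (hgK : ∀ p ∉ K, g p = 0) :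
    Integrable g (areaMeasure x) ∧ ∫ p, g p ∂(areaMeasure x) =
      ∫ y in (extChartAt (𝓡∂ n) q).target,
        chartDensity x q y * g ((extChartAt (𝓡∂ n) q).symm y) := by
  have hgU : ∀ p ∉ (extChartAt (𝓡∂ n) q).source, g p = 0 := fun p hp => hgK p fun h => hp (hKq h)
  have hsupp : Function.support g ⊆ (extChartAt (𝓡∂ n) q).source := fun p hp => by
    by_contra h; exact hp (hgU p h)
  have hdens : AEMeasurable (fun y => ENNReal.ofReal (chartDensity x q y))
      ((volume : Measure (Euc n)).restrict (extChartAt (𝓡∂ n) q).target) :=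
    ((continuousOn_chartDensity hx q).aemeasurable (measurableSet_target q)).ennreal_ofReal
  have hsymm : AEMeasurable (extChartAt (𝓡∂ n) q).symm
      (((volume : Measure (Euc n)).restrict (extChartAt (𝓡∂ n) q).target).withDensity
        fun y => ENNReal.ofReal (chartDensity x q y)) :=
    (aemeasurable_chart_symm q).mono_ac (withDensity_absolutelyContinuous _ _)
  have hd0 : ∀ y, (ENNReal.ofReal (chartDensity x q y)).toReal = chartDensity x q y := fun y =>
    ENNReal.toReal_ofReal (Real.sqrt_nonneg _)
  have hlt : ∀ᵐ y ∂((volume : Measure (Euc n)).restrict (extChartAt (𝓡∂ n) q).target),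
      ENNReal.ofReal (chartDensity x q y) < ⊤ := Filter.Eventually.of_forall fun _ =>
    ENNReal.ofReal_lt_top
  constructor
  · rw [← integrableOn_iff_integrable_of_support_subset hsupp, IntegrableOn,
      areaMeasure_restrict hx, chartArea,
      integrable_map_measure hg.measurable.aestronglyMeasurable hsymm,
      integrable_withDensity_iff_integrable_smul₀' hdens hlt]
    simp only [hd0, smul_eq_mul, Function.comp_apply]
    have hKt : extChartAt (𝓡∂ n) q '' K ⊆ (extChartAt (𝓡∂ n) q).target := by
      rintro _ ⟨p, hp, rfl⟩; exact (extChartAt (𝓡∂ n) q).map_source (hKq hp)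
    have hKc : IsCompact (extChartAt (𝓡∂ n) q '' K) :=
      hK.image_of_continuousOn ((continuousOn_extChartAt q).mono hKq)
    have hcont : ContinuousOn (fun y => chartDensity x q y * g ((extChartAt (𝓡∂ n) q).symm y))
        (extChartAt (𝓡∂ n) q).target :=
      (continuousOn_chartDensity hx q).mul
        (hg.comp_continuousOn (continuousOn_extChartAt_symm q))
    refine ((hcont.mono hKt).integrableOn_compact hKc).of_forall_sdiff_eq_zero
      (measurableSet_target q) fun y hy => ?_
    rw [hgK _ fun h => hy.2 ⟨_, h, (extChartAt (𝓡∂ n) q).right_inv hy.1⟩, mul_zero]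
  · rw [← setIntegral_eq_integral_of_forall_compl_eq_zero hgU, areaMeasure_restrict hx, chartArea,
      integral_map hsymm hg.measurable.aestronglyMeasurable,
      integral_withDensity_eq_integral_toReal_smul₀ hdens hlt]
    simp only [hd0, smul_eq_mul]

end Area

end HypBall

namespace HypBall

/-! ### The divergence theorem in a chart, and partitions of unity. -/

section ChartDivergence

variable {n : ℕ} [NeZero n]

theorem setIntegral_divergence_range_eq_zero {F : Euc n → Fin n → ℝ} {dv : Euc n → ℝ}
    {K : Set (Euc n)} (hK : IsCompact K) (hF0 : ∀ y ∉ K, ∀ i, F y i = 0)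
    (hdv0 : ∀ y ∉ K, dv y = 0) (hFc : ∀ i, ContinuousOn (fun y => F y i) (Set.range (𝓡∂ n)))
    (hdc : ContinuousOn dv (Set.range (𝓡∂ n)))
    (hd : ∀ y ∈ interior (Set.range (𝓡∂ n)), ∃ G : Fin n → Euc n →L[ℝ] ℝ,
      (∀ i, HasFDerivAt (fun y => F y i) (G i) y) ∧ ∑ i, G i (stdVec i) = dv y)
    (hb : ∀ y, y 0 = 0 → F y 0 = 0) : ∫ y in Set.range (𝓡∂ n), dv y = 0 := by
  obtain ⟨m, rfl⟩ := Nat.exists_eq_succ_of_ne_zero (NeZero.ne n)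
  rw [interior_range_modelWithCornersEuclideanHalfSpace] at hd
  rw [range_modelWithCornersEuclideanHalfSpace] at hFc hdc ⊢
  exact setIntegral_divergence_halfSpace_eq_zero hK hF0 hdv0 hFc hdc hd hb

variable {M : Type*} [TopologicalSpace M] [ChartedSpace (EuclideanHalfSpace n) M]

/-- Extension by zero from the chart target to the half space. Near each point of the half space the
extended field either agrees with `F` or vanishes, as `K` is closed and contained in the target. -/
theorem setIntegral_divergence_target_eq_zero {q : M} {F : Euc n → Fin n → ℝ} {dv : Euc n → ℝ}
    {K : Set (Euc n)} (hK : IsCompact K) (hKt : K ⊆ (extChartAt (𝓡∂ n) q).target)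
    (hF0 : ∀ y ∈ (extChartAt (𝓡∂ n) q).target, y ∉ K → ∀ i, F y i = 0)
    (hdv0 : ∀ y ∈ (extChartAt (𝓡∂ n) q).target, y ∉ K → dv y = 0)
    (hFc : ∀ y ∈ (extChartAt (𝓡∂ n) q).target, ∀ i,
      ContinuousWithinAt (fun y => F y i) (Set.range (𝓡∂ n)) y)
    (hdc : ∀ y ∈ (extChartAt (𝓡∂ n) q).target, ContinuousWithinAt dv (Set.range (𝓡∂ n)) y)
    (hd : ∀ y ∈ (extChartAt (𝓡∂ n) q).target, y ∈ interior (Set.range (𝓡∂ n)) →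
      ∃ G : Fin n → Euc n →L[ℝ] ℝ,
      (∀ i, HasFDerivAt (fun y => F y i) (G i) y) ∧ ∑ i, G i (stdVec i) = dv y)
    (hb : ∀ y ∈ (extChartAt (𝓡∂ n) q).target, y 0 = 0 → F y 0 = 0) :
    ∫ y in (extChartAt (𝓡∂ n) q).target, dv y = 0 := by
  set T := (extChartAt (𝓡∂ n) q).target
  have hTr : T ⊆ Set.range (𝓡∂ n) := extChartAt_target_subset_range q
  let F₀ : Euc n → Fin n → ℝ := fun y i => T.indicator (fun y => F y i) y
  have hF₀ : ∀ y ∉ K, ∀ i, F₀ y i = 0 := fun y hy i => by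
    by_cases hT : y ∈ T
    · exact (Set.indicator_of_mem hT _).trans (hF0 y hT hy i)
    · exact Set.indicator_of_notMem hT _
  have hdv₀ : ∀ y ∉ K, T.indicator dv y = 0 := fun y hy => by
    by_cases hT : y ∈ T
    · exact (Set.indicator_of_mem hT _).trans (hdv0 y hT hy)
    · exact Set.indicator_of_notMem hT _
  have hcont : ∀ h : Euc n → ℝ, (∀ y ∉ K, T.indicator h y = 0) →
      (∀ y ∈ T, ContinuousWithinAt h (Set.range (𝓡∂ n)) y) →
      ContinuousOn (T.indicator h) (Set.range (𝓡∂ n)) := by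
    intro h h0 hc y _
    by_cases hT : y ∈ T
    · refine (hc y hT).congr_of_eventuallyEq ?_ (Set.indicator_of_mem hT _)
      filter_upwards [target_mem_nhdsWithin hT] with z hz using Set.indicator_of_mem hz _
    · have h1 : Kᶜ ∈ nhds y := hK.isClosed.isOpen_compl.mem_nhds fun hy => hT (hKt hy)
      refine (continuousWithinAt_const (b := (0 : ℝ))).congr_of_eventuallyEq ?_
        (Set.indicator_of_notMem hT _)
      filter_upwards [mem_nhdsWithin_of_mem_nhds h1] with z hz using h0 z hz
  have h1 := setIntegral_divergence_range_eq_zero (F := F₀) hK hF₀ hdv₀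
    (fun i => hcont _ (fun y hy => hF₀ y hy i) fun y hy => hFc y hy i) (hcont _ hdv₀ hdc) ?_ ?_
  · have hm : MeasurableSet T := measurableSet_target q
    rwa [setIntegral_indicator hm, Set.inter_eq_right.mpr hTr] at h1
  · intro y hy
    by_cases hT : y ∈ T
    · obtain ⟨G, hG, hGs⟩ := hd y hT hy
      refine ⟨G, fun i => (hG i).congr_of_eventuallyEq ?_,
        hGs.trans (Set.indicator_of_mem hT _).symm⟩
      have := target_mem_nhdsWithin hT
      rw [mem_interior_iff_mem_nhds] at hy
      rw [nhdsWithin_eq_nhds.mpr hy] at this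
      filter_upwards [this] with z hz using Set.indicator_of_mem hz _
    · have h1 : Kᶜ ∈ nhds y := hK.isClosed.isOpen_compl.mem_nhds fun hy => hT (hKt hy)
      refine ⟨fun _ => 0, fun i => (hasFDerivAt_const (0 : ℝ) y).congr_of_eventuallyEq ?_, ?_⟩
      · filter_upwards [h1] with z hz using hF₀ z hz i
      · rw [Set.indicator_of_notMem hT]; simp
  · intro y hy
    by_cases hT : y ∈ T
    · exact (Set.indicator_of_mem hT _).trans (hb y hT hy)
    · exact Set.indicator_of_notMem hT _

theorem continuous_of_chart [IsManifold (𝓡∂ n) ∞ M] {g : M → ℝ} {G : M → Euc n → ℝ}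
    (hG : ∀ q, ∀ y ∈ (extChartAt (𝓡∂ n) q).target,
      ContinuousWithinAt (G q) (Set.range (𝓡∂ n)) y)
    (hgG : ∀ q, ∀ y ∈ (extChartAt (𝓡∂ n) q).target, g ((extChartAt (𝓡∂ n) q).symm y) = G q y) :
    Continuous g := by
  refine continuous_iff_continuousAt.mpr fun p => ?_
  have h1 : Filter.Tendsto (extChartAt (𝓡∂ n) p) (nhds p)
      (nhdsWithin (extChartAt (𝓡∂ n) p p) (Set.range (𝓡∂ n))) :=
    tendsto_nhdsWithin_iff.mpr ⟨continuousAt_extChartAt p, Filter.Eventually.of_forall fun z =>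
      ⟨_, rfl⟩⟩
  have h2 : ContinuousAt (fun z => G p (extChartAt (𝓡∂ n) p z)) p :=
    (hG p _ (mem_extChartAt_target p)).tendsto.comp h1
  refine h2.congr ?_
  filter_upwards [extChartAt_source_mem_nhds (I := 𝓡∂ n) p] with z hz
  rw [← hgG p _ ((extChartAt (𝓡∂ n) p).map_source hz), (extChartAt (𝓡∂ n) p).left_inv hz]

theorem tanMap_eq_zero {f : M → ℝ} {p : M} (hp : p ∉ tsupport f) :
    tanMap (n := n) f p = 0 := by
  have h1 : f =ᶠ[nhds p] fun _ => 0 := notMem_tsupport_iff_eventuallyEq.mp hp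
  rw [tanMap, h1.mfderiv_eq]
  exact mfderiv_const

theorem exists_hasMFDerivAt_sum (s : Finset M) {f : M → M → ℝ}
    (hf : ∀ q, ContMDiff (𝓡∂ n) 𝓘(ℝ, ℝ) ∞ (f q)) (p : M) :
    ∃ L : Euc n →L[ℝ] ℝ, L = ∑ q ∈ s, tanMap (f q) p ∧
      HasMFDerivAt (𝓡∂ n) 𝓘(ℝ, ℝ) (∑ q ∈ s, f q) p L := by
  classical
  induction s using Finset.induction_on with
  | empty => exact ⟨0, rfl, hasMFDerivAt_const 0 p⟩
  | insert q s hq ih =>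
    obtain ⟨L, hL, h⟩ := ih
    refine ⟨tanMap (f q) p + L, by rw [Finset.sum_insert hq, hL], ?_⟩
    rw [Finset.sum_insert hq]
    exact ((hf q).mdifferentiableAt (by simp) (x := p)).hasMFDerivAt.add h

/-- A finite smooth partition of unity subordinate to the charts. -/
theorem exists_finite_partition [IsManifold (𝓡∂ n) ∞ M] [T2Space M] [CompactSpace M] :
    ∃ (s : Finset M) (f : M → M → ℝ), (∀ q, ContMDiff (𝓡∂ n) 𝓘(ℝ, ℝ) ∞ (f q)) ∧
      (∀ q, tsupport (f q) ⊆ (extChartAt (𝓡∂ n) q).source) ∧ ∀ p, ∑ q ∈ s, f q p = 1 := by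
  obtain ⟨f, hf⟩ := SmoothPartitionOfUnity.exists_isSubordinate_chartAt_source (𝓡∂ n) M
  have hfin := f.locallyFinite.finite_nonempty_of_compact
  refine ⟨hfin.toFinset, fun q => f q, fun q => (f q).contMDiff, fun q => ?_, fun p => ?_⟩
  · rw [extChartAt_source]
    exact hf q
  · rw [← f.sum_eq_one (Set.mem_univ p)]
    refine (finsum_eq_sum_of_support_subset _ fun q hq => ?_).symm
    rw [Set.Finite.coe_toFinset]
    exact ⟨p, hq⟩

end ChartDivergence

/-! ### The global divergence theorem. -/

section Balance

variable {n : ℕ} [NeZero n] {M : Type*} [TopologicalSpace M]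
  [ChartedSpace (EuclideanHalfSpace n) M]

theorem balance_eq_zero (t R θ : ℝ) (a : Euc (n + 1)) (x ν : M → Euc (n + 1)) {f : M → ℝ} {p : M}
    (hp : p ∉ tsupport f) : balance t R θ a x ν f p = 0 := by
  have h : stdImage (0 : Euc n →L[ℝ] ℝ) = 0 := rfl
  rw [balance, tanMap_eq_zero (n := n) hp, image_eq_zero_of_notMem_tsupport hp, balanceNum, h]
  simp [slotSum, AlternatingMap.map_update_zero]

/-- `balance` is linear in the pair `(f, df)`, and a partition of unity has `∑ f = 1` and `∑ df =
0`. -/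
theorem sum_balance (t R θ : ℝ) (a : Euc (n + 1)) (x ν : M → Euc (n + 1)) {s : Finset M}
    {f : M → M → ℝ} (hf : ∀ q, ContMDiff (𝓡∂ n) 𝓘(ℝ, ℝ) ∞ (f q))
    (hs : ∀ p, ∑ q ∈ s, f q p = 1) (p : M) :
    ∑ q ∈ s, balance t R θ a x ν (f q) p = balance t R θ a x ν (fun _ => 1) p := by
  have h1 : ∑ q ∈ s, tanMap (n := n) (f q) p = 0 := by
    obtain ⟨L, hL, h2⟩ := exists_hasMFDerivAt_sum s hf p
    have h3 : (∑ q ∈ s, f q) = fun _ => 1 := by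
      funext p; rw [Finset.sum_apply, hs]
    rw [h3] at h2
    rw [← hL]
    exact hasMFDerivAt_unique h2 (hasMFDerivAt_const 1 p)
  have h0 : tanMap (n := n) (fun _ : M => (1 : ℝ)) p = 0 := mfderiv_const
  have hB : ∀ g : Euc n →L[ℝ] ℝ, ∀ w : Fin n → Mink n, ∀ Φ N z : Mink n,
      slotSum Φ N w (fun i => stdImage g i • z) =
        ∑ i, g (stdVec i) * tanDet Φ N (Function.update w i z) := fun g w Φ N z => by
    refine Finset.sum_congr rfl fun i _ => ?_
    rw [AlternatingMap.map_update_smul]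
    rfl
  simp only [balance, balanceNum, hB, h0]
  rw [← Finset.sum_div, Finset.sum_add_distrib, ← Finset.sum_mul, hs, Finset.sum_comm]
  congr 2
  refine Finset.sum_congr rfl fun i _ => ?_
  rw [← Finset.sum_mul]
  congr 1
  have := congrArg (fun L : Euc n →L[ℝ] ℝ => L (stdVec i)) h1
  rwa [_root_.sum_apply] at this

variable [IsManifold (𝓡∂ n) ∞ M]

namespace IsCapillaryImmersion

variable {R θ : ℝ} {x ν : M → Euc (n + 1)}

theorem continuous_balance (hx : IsCapillaryImmersion R θ x ν) (t : ℝ) (a : Euc (n + 1)) {f : M → ℝ}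
    (hf : ContMDiff (𝓡∂ n) 𝓘(ℝ, ℝ) ∞ f) : Continuous (balance t R θ a x ν f) := by
  refine continuous_of_chart
    (G := fun q y => fluxDiv t R θ a x ν f q y / chartDet x ν q y) (fun q y hy => ?_)
    fun q y hy => ?_
  · exact (hx.continuousWithinAt_fluxDiv t a hf hy).div (hx.continuousWithinAt_chartDet hy)
      (hx.chartDet_ne_zero hy)
  · rw [hx.fluxDiv_eq t a hf hy, mul_div_cancel_left₀ _ (hx.chartDet_ne_zero hy)]

variable [CompactSpace M] [MeasurableSpace M] [BorelSpace M]

theorem integrable_and_integral_balance_of_tsupport (hx : IsCapillaryImmersion R θ x ν) (hR : 0 < R)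
    (hθ₀ : 0 < θ) (hθπ : θ < Real.pi) (t : ℝ) (a : Euc (n + 1)) {f : M → ℝ}
    (hf : ContMDiff (𝓡∂ n) 𝓘(ℝ, ℝ) ∞ f) {q : M}
    (hfq : tsupport f ⊆ (extChartAt (𝓡∂ n) q).source) :
    Integrable (balance t R θ a x ν f) (areaMeasure x) ∧
      ∫ p, balance t R θ a x ν f p ∂(areaMeasure x) = 0 := by
  have hK : IsCompact (tsupport f) := (isClosed_tsupport f).isCompact
  obtain ⟨hint, heq⟩ := integrable_and_integral_chart hx q (hx.continuous_balance t a hf) hK hfq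
    fun p hp => balance_eq_zero t R θ a x ν hp
  refine ⟨hint, heq.trans ?_⟩
  set T := (extChartAt (𝓡∂ n) q).target with hTdef
  set K := extChartAt (𝓡∂ n) q '' tsupport f with hKdef
  have hKc : IsCompact K := hK.image_of_continuousOn ((continuousOn_extChartAt q).mono hfq)
  have hKt : K ⊆ T := by
    rintro _ ⟨p, hp, rfl⟩; exact (extChartAt (𝓡∂ n) q).map_source (hfq hp)
  have hKsymm : ∀ y ∈ T, y ∉ K → (extChartAt (𝓡∂ n) q).symm y ∉ tsupport f := fun y hy hyK h =>
    hyK ⟨_, h, (extChartAt (𝓡∂ n) q).right_inv hy⟩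
  -- The area density is the absolute value of `chartDet`, while the divergence identity carries
  -- `chartDet` itself. The sign `ε` is locally constant because `chartDet` is continuous without
  -- zeros, so it may be moved into the flux.
  let ε : Euc n → ℝ := fun y => |chartDet x ν q y| / chartDet x ν q y
  have hε : ∀ y ∈ T, ContinuousWithinAt ε (Set.range (𝓡∂ n)) y := fun y hy =>
    (hx.continuousWithinAt_chartDet hy).abs.div (hx.continuousWithinAt_chartDet hy)
      (hx.chartDet_ne_zero hy)
  have hcongr : ∀ y ∈ T, chartDensity x q y * balance t R θ a x ν f ((extChartAt (𝓡∂ n) q).symm y) =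
      ε y * fluxDiv t R θ a x ν f q y := fun y hy => by
    rw [chartDensity_eq hx hy, hx.fluxDiv_eq t a hf hy, ← mul_assoc,
      div_mul_cancel₀ _ (hx.chartDet_ne_zero hy)]
  rw [setIntegral_congr_fun (measurableSet_target q) hcongr]
  refine setIntegral_divergence_target_eq_zero
    (F := fun y i => ε y * fluxField t R θ a x ν f q y i) hKc hKt ?_ ?_ ?_ ?_ ?_ ?_
  · intro y hy hyK i
    have : f ((extChartAt (𝓡∂ n) q).symm y) = 0 :=
      image_eq_zero_of_notMem_tsupport (hKsymm y hy hyK)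
    rw [fluxField, inChart, Function.comp_apply, this, zero_mul, mul_zero]
  · intro y hy hyK
    rw [hx.fluxDiv_eq t a hf hy, balance_eq_zero t R θ a x ν (hKsymm y hy hyK), mul_zero, mul_zero]
  · exact fun y hy i => (hε y hy).mul (hx.continuousWithinAt_fluxField t a hf hy i)
  · exact fun y hy => (hε y hy).mul (hx.continuousWithinAt_fluxDiv t a hf hy)
  · intro y hy hyi
    obtain ⟨G, hG, hGs⟩ := hx.hasFDerivAt_fluxField t a hf hy hyi
    have hcont : ContinuousAt (chartDet x ν q) y :=
      (hx.continuousWithinAt_chartDet hy).continuousAt (mem_interior_iff_mem_nhds.mp hyi)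
    have hev : ∀ᶠ z in nhds y, ε z = ε y := by
      rcases (hx.chartDet_ne_zero hy).lt_or_gt with h | h
      · filter_upwards [hcont.eventually_lt_const h] with z hz
        change |chartDet x ν q z| / chartDet x ν q z = |chartDet x ν q y| / chartDet x ν q y
        rw [abs_of_neg hz, abs_of_neg h, neg_div, neg_div, div_self hz.ne, div_self h.ne]
      · filter_upwards [hcont.eventually_const_lt h] with z hz
        change |chartDet x ν q z| / chartDet x ν q z = |chartDet x ν q y| / chartDet x ν q y
        rw [abs_of_pos hz, abs_of_pos h, div_self hz.ne', div_self h.ne']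
    refine ⟨fun i => ε y • G i, fun i => ((hG i).const_mul (ε y)).congr_of_eventuallyEq ?_, ?_⟩
    · filter_upwards [hev] with z hz
      rw [hz]
    · simp only [_root_.smul_apply, smul_eq_mul]
      rw [← Finset.mul_sum, hGs]
  · intro y hy h0
    rw [hx.fluxField_eq_zero hR hθ₀ hθπ t a f hy h0, mul_zero]

variable [T2Space M]

/-- Continuous functions on a compact hypersurface are integrable. -/
theorem integrable_of_continuous (hx : IsCapillaryImmersion R θ x ν) {h : M → ℝ}
    (hh : Continuous h) : Integrable h (areaMeasure x) := by
  obtain ⟨s, f, hf, hfs, hs⟩ := exists_finite_partition (n := n) (M := M)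
  have h1 : h = fun p => ∑ q ∈ s, f q p * h p := by
    funext p
    rw [← Finset.sum_mul, hs, one_mul]
  rw [h1]
  refine integrable_finsetSum _ fun q _ => (integrable_and_integral_chart hx q
    ((hf q).continuous.mul hh) (isClosed_tsupport (f q)).isCompact (hfs q) fun p hp => ?_).1
  rw [Pi.mul_apply, image_eq_zero_of_notMem_tsupport hp, zero_mul]

/-- The divergence theorem for the Newton transform of the test field. -/
theorem integral_balance_eq_zero (hx : IsCapillaryImmersion R θ x ν) (hR : 0 < R) (hθ₀ : 0 < θ)
    (hθπ : θ < Real.pi) (t : ℝ) (a : Euc (n + 1)) :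
    ∫ p, balance t R θ a x ν (fun _ => 1) p ∂(areaMeasure x) = 0 := by
  obtain ⟨s, f, hf, hfs, hs⟩ := exists_finite_partition (n := n) (M := M)
  have h1 := fun q => hx.integrable_and_integral_balance_of_tsupport hR hθ₀ hθπ t a (hf q) (hfs q)
  simp only [← sum_balance t R θ a x ν hf hs]
  rw [integral_finsetSum _ fun q _ => (h1 q).1]
  exact Finset.sum_eq_zero fun q _ => (h1 q).2

end IsCapillaryImmersion

end Balance

end HypBall

namespace HypBall

/-! ### Comparing coefficients in `t`. -/

section Coefficients

/-- Inversion of the Vandermonde matrix at the nodes `0, …, n`. It serves to show that each `σ_k` is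
continuous, as a fixed linear combination of the continuous functions `det (1 + j A)`; the roots
themselves are not handled. -/
theorem exists_coefficients_of_eval (n : ℕ) : ∃ c : Fin (n + 1) → Fin (n + 1) → ℝ,
    ∀ s : ℕ → ℝ, ∀ k : Fin (n + 1),
      s k = ∑ j, c k j * ∑ l ∈ Finset.range (n + 1), s l * (j : ℝ) ^ l := by
  let V := Matrix.vandermonde fun i : Fin (n + 1) => (i : ℝ)
  have hV : IsUnit V.det := (Matrix.det_vandermonde_ne_zero_iff.mpr fun i j hij =>
    Fin.ext (Nat.cast_injective hij)).isUnit
  refine ⟨fun k j => (V⁻¹ : Matrix _ _ ℝ) k j, fun s k => ?_⟩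
  have h1 : V.mulVec (fun l => s l) =
      fun j : Fin (n + 1) => ∑ l ∈ Finset.range (n + 1), s l * (j : ℝ) ^ l := by
    funext j
    rw [Finset.sum_range, Matrix.mulVec, dotProduct]
    exact Finset.sum_congr rfl fun l _ => mul_comm _ _
  have h2 := congrFun (congrArg V⁻¹.mulVec h1) k
  rw [Matrix.mulVec_mulVec, Matrix.nonsing_inv_mul _ hV, Matrix.one_mulVec] at h2
  exact h2

theorem eq_zero_of_sum_pow_eq_zero {n : ℕ} {c : ℕ → ℝ}
    (h : ∀ t : ℝ, ∑ k ∈ Finset.range n, t ^ k * c k = 0) {k : ℕ} (hk : k < n) : c k = 0 := by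
  have h1 : ∑ k ∈ Finset.range n, Polynomial.monomial k (c k) = 0 := by
    refine Polynomial.funext fun t => ?_
    rw [Polynomial.eval_finsetSum, Polynomial.eval_zero, ← h t]
    refine Finset.sum_congr rfl fun k _ => ?_
    rw [Polynomial.eval_monomial, mul_comm]
  have h2 := congrArg (fun p => Polynomial.coeff p k) h1
  simpa [Polynomial.finsetSum_coeff, Polynomial.coeff_monomial, hk] using h2

/-- The left side is `α (n P - t P') - β P'` for `P = ∑ s_k t^k`. The term of degree `n` drops out
of `n P - t P'`, and `P'` is reindexed by one. -/
theorem sum_range_mul_sub_deriv (n : ℕ) (s : ℕ → ℝ) (t α β : ℝ) :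
    α * (n * ∑ k ∈ Finset.range (n + 1), s k * t ^ k -
        t * ∑ k ∈ Finset.range (n + 1), s k * (k * t ^ (k - 1))) -
      β * ∑ k ∈ Finset.range (n + 1), s k * (k * t ^ (k - 1)) =
    ∑ k ∈ Finset.range n, t ^ k * ((n - k) * (s k * α) - (k + 1) * (s (k + 1) * β)) := by
  have h1 : ∀ k : ℕ, t * (s k * (k * t ^ (k - 1))) = k * (s k * t ^ k) := fun k => by
    cases k with
    | zero => simp
    | succ k => rw [Nat.add_sub_cancel, pow_succ]; ring
  have h2 : n * ∑ k ∈ Finset.range (n + 1), s k * t ^ k -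
      t * ∑ k ∈ Finset.range (n + 1), s k * (k * t ^ (k - 1)) =
      ∑ k ∈ Finset.range n, (n - k) * (s k * t ^ k) := by
    rw [Finset.mul_sum, Finset.mul_sum, ← Finset.sum_sub_distrib, Finset.sum_range_succ, h1,
      sub_self, add_zero]
    exact Finset.sum_congr rfl fun k _ => by rw [h1]; ring
  rw [h2, Finset.sum_range_succ', Finset.mul_sum, Nat.cast_zero, zero_mul, mul_zero, add_zero,
    Finset.mul_sum, ← Finset.sum_sub_distrib]
  refine Finset.sum_congr rfl fun k _ => ?_
  rw [Nat.add_sub_cancel, Nat.cast_succ]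
  ring

end Coefficients

/-! ### The integral formula. -/

section Capillary

variable {n : ℕ} [NeZero n] {M : Type*} [TopologicalSpace M]
  [ChartedSpace (EuclideanHalfSpace n) M]

namespace IsCapillaryImmersion

variable {R θ : ℝ} {x ν : M → Euc (n + 1)}

theorem mink_testMap_posMap (hx : IsCapillaryImmersion R θ x ν) (a : Euc (n + 1)) (p : M) :
    mink (testMap R θ a x ν p) (posMap x p) =
      funV a (x p) + Real.sinh R * Real.cos θ * hypMetric (x p) (fieldY a (x p)) (ν p) := by
  have hy := hx.norm_lt_one p
  have h1 : mink (boost a (posMap x p)) (posMap x p) = 0 := by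
    have := mink_boost a (posMap x p) (posMap x p)
    rw [mink_comm (posMap x p)] at this
    linarith
  have h2 : mink (boost a (norMap x ν p)) (posMap x p) =
      -hypMetric (x p) (fieldY a (x p)) (ν p) := by
    rw [mink_boost, posMap, ← push_fieldY hy, mink_comm, norMap, mink_push_push hy]
  have h3 : mink ((a, 0) : Mink n) (posMap x p) = funV a (x p) := by
    rw [mink_apply, posMap, hypPos, funV, confFactor, inner_smul_right, real_inner_comm]
    ring
  rw [testMap, testField]
  simp only [map_sub, map_add, map_smul, LinearMap.sub_apply, LinearMap.add_apply,
    LinearMap.smul_apply, smul_eq_mul, h1, h2, h3]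
  ring

variable [IsManifold (𝓡∂ n) ∞ M]

/-- The part `c L N` drops out since `L` is skew. By `push_fieldX` the rest differs from `X_a` by a
multiple of `Φ`, which is orthogonal to `N`. -/
theorem mink_testMap_norMap (hx : IsCapillaryImmersion R θ x ν) (a : Euc (n + 1)) (p : M) :
    mink (testMap R θ a x ν p) (norMap x ν p) = hypMetric (x p) (fieldX R a (x p)) (ν p) := by
  have hy := hx.norm_lt_one p
  have h1 : mink (boost a (norMap x ν p)) (norMap x ν p) = 0 := by
    have := mink_boost a (norMap x ν p) (norMap x ν p)
    rw [mink_comm (norMap x ν p)] at this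
    linarith
  have h2 : ((a, 0) : Mink n) = push (x p) (fieldX R a (x p)) - funV a (x p) • posMap x p +
      Real.cosh R • boost a (posMap x p) := by
    rw [push_fieldX hy, posMap]; abel
  have h3 : mink (posMap x p) (norMap x ν p) = 0 := (hx.isTangentData p).pos_nor
  rw [testMap, testField, h2, ← mink_push_push hy]
  change _ = mink _ (norMap x ν p)
  simp only [map_sub, map_add, map_smul, LinearMap.sub_apply, LinearMap.add_apply,
    LinearMap.smul_apply, smul_eq_mul, h1, h3]
  ring

theorem det_one_add_smul_weingarten (hx : IsCapillaryImmersion R θ x ν) (p : M) (t : ℝ) :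
    (1 + t • weingarten x ν p).det =
      ∑ k ∈ Finset.range (n + 1), sigma k x ν p * t ^ k := by
  refine det_one_add_smul_eq_sum_esymm ?_ t
  rw [hx.weingarten_eq]
  have h := (hx.isTangentData p).isFrame
  exact charpoly_splits_of_posDef h.posDef (by ext i j; exact h.symm j i)

/-- For `f = 1` the gradient term is absent. The two slot sums are `n P - t P'` and `P'` times the
density, where `P'` is found by differentiating `det (1 + t A)` both as a determinant and as a
polynomial in `t`. -/
theorem balance_one (hx : IsCapillaryImmersion R θ x ν) (t : ℝ) (a : Euc (n + 1)) (p : M) :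
    balance t R θ a x ν (fun _ => 1) p = ∑ k ∈ Finset.range n, t ^ k *
      ((n - k) * (sigma k x ν p * mink (testMap R θ a x ν p) (posMap x p)) -
        (k + 1) * (sigma (k + 1) x ν p * mink (testMap R θ a x ν p) (norMap x ν p))) := by
  have h := (hx.isTangentData p).isFrame
  have hd := h.det_ne_zero
  have h1 := h.hasDerivAt_det t
  rw [← hx.weingarten_eq] at h1
  have h2 : HasDerivAt (fun s : ℝ => (1 + s • weingarten x ν p).det)
      (∑ k ∈ Finset.range (n + 1), sigma k x ν p * (k * t ^ (k - 1))) t := by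
    rw [funext fun s => hx.det_one_add_smul_weingarten p s]
    exact HasDerivAt.fun_sum fun k _ => (hasDerivAt_pow k t).const_mul _
  have h3 := h1.unique h2
  rw [div_eq_iff hd] at h3
  have h4 := h.sum_update_frame t
  rw [← hx.weingarten_eq, h3, hx.det_one_add_smul_weingarten] at h4
  rw [← sum_range_mul_sub_deriv, balance]
  refine (div_eq_iff hd).mpr ?_
  rw [balanceNum]
  have h5 : tanMap (n := n) (fun _ : M => (1 : ℝ)) p = 0 := mfderiv_const
  have h6 : slotSum (posMap x p) (norMap x ν p)
      (stdImage (tanMap (posMap x) p + t • tanMap (norMap x ν) p))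
      (fun i => stdImage (0 : Euc n →L[ℝ] ℝ) i • testMap R θ a x ν p) = 0 := by
    refine Finset.sum_eq_zero fun i _ => (tanDet _ _).map_coord_zero i ?_
    rw [Function.update_self]
    exact zero_smul _ _
  rw [h5, h6]
  unfold slotSum
  refine (congrArg₂ (fun u v => 1 * (mink (testMap R θ a x ν p) (posMap x p) * u -
    mink (testMap R θ a x ν p) (norMap x ν p) * v) + 0) h4 h3).trans ?_
  change _ = _ * tanDet (posMap x p) (norMap x ν p) fun i => tanMap (posMap x) p (stdVec i)
  ring

theorem continuous_det_weingarten (hx : IsCapillaryImmersion R θ x ν) (t : ℝ) :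
    Continuous fun p => (1 + t • weingarten x ν p).det := by
  refine continuous_of_chart (G := fun q y =>
    tanDet (inChart (posMap x) q y) (inChart (norMap x ν) q y)
      (stdImage (chartDeriv (posMap x) q y + t • chartDeriv (norMap x ν) q y)) /
      chartDet x ν q y) (fun q y hy => ?_) fun q y hy => ?_
  · exact (continuousWithinAt_tanDet (continuousWithinAt_inChart hx.contMDiff_posMap hy)
      (continuousWithinAt_inChart hx.contMDiff_norMap hy)
      (continuousWithinAt_stdImage ((continuousWithinAt_chartDeriv hx.contMDiff_posMap hy).add
        ((continuousWithinAt_chartDeriv hx.contMDiff_norMap hy).const_smul t)))).div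
      (hx.continuousWithinAt_chartDet hy) (hx.chartDet_ne_zero hy)
  · rw [eq_div_iff (hx.chartDet_ne_zero hy), chartDet, chartDeriv, chartDeriv,
      fderivWithin_inChart hx.contMDiff_posMap hy, fderivWithin_inChart hx.contMDiff_norMap hy]
    set p := (extChartAt (𝓡∂ n) q).symm y with hp
    have h := (hx.isTangentData p).isFrame
    have h1 : (tanMap (posMap x) p).comp (chartJac q y) +
        t • (tanMap (norMap x ν) p).comp (chartJac q y) =
        (tanMap (posMap x) p + t • tanMap (norMap x ν) p).comp (chartJac q y) := by
      ext1 v; simp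
    rw [h1, tanDet_comp_chartJac, tanDet_comp_chartJac, hx.weingarten_eq, mul_left_comm]
    exact congrArg _ (h.tanDet_variation t).symm

theorem continuous_sigma (hx : IsCapillaryImmersion R θ x ν) {k : ℕ} (hk : k ≤ n) :
    Continuous (sigma k x ν) := by
  obtain ⟨c, hc⟩ := exists_coefficients_of_eval n
  have h1 : sigma k x ν = fun p => ∑ j : Fin (n + 1),
      c ⟨k, Nat.lt_succ_of_le hk⟩ j * (1 + (j : ℝ) • weingarten x ν p).det := by
    funext p
    simp only [hx.det_one_add_smul_weingarten]
    exact hc (fun k => sigma k x ν p) ⟨k, Nat.lt_succ_of_le hk⟩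
  rw [h1]
  exact continuous_finsetSum _ fun j _ => (hx.continuous_det_weingarten j).const_mul _

variable [T2Space M] [CompactSpace M] [MeasurableSpace M] [BorelSpace M]

/-- The integral of `balance` with `f = 1` is a polynomial in `t` that vanishes for every real `t`;
the assertion is that its coefficient of `t^k` is zero. -/
theorem integral_sigma (hx : IsCapillaryImmersion R θ x ν) (hR : 0 < R) (hθ₀ : 0 < θ)
    (hθπ : θ < Real.pi) (a : Euc (n + 1)) {k : ℕ} (hk : k < n) :
    ((n : ℝ) - k) * ∫ p, sigma k x ν p * mink (testMap R θ a x ν p) (posMap x p) ∂(areaMeasure x) =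
      (k + 1) * ∫ p, sigma (k + 1) x ν p * mink (testMap R θ a x ν p) (norMap x ν p)
        ∂(areaMeasure x) := by
  have hz := (hx.contMDiff_testMap a).continuous
  have hmink : ∀ {F : M → Mink n}, Continuous F →
      Continuous fun p => mink (testMap R θ a x ν p) (F p) := fun hF =>
    (hz.fst.inner hF.fst).sub (hz.snd.mul hF.snd)
  have hα : ∀ k ≤ n, Integrable
      (fun p => sigma k x ν p * mink (testMap R θ a x ν p) (posMap x p)) (areaMeasure x) :=
    fun k hk => hx.integrable_of_continuous
      ((hx.continuous_sigma hk).mul (hmink hx.contMDiff_posMap.continuous))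
  have hβ : ∀ k ≤ n, Integrable
      (fun p => sigma k x ν p * mink (testMap R θ a x ν p) (norMap x ν p)) (areaMeasure x) :=
    fun k hk => hx.integrable_of_continuous
      ((hx.continuous_sigma hk).mul (hmink hx.contMDiff_norMap.continuous))
  rw [← sub_eq_zero]
  refine eq_zero_of_sum_pow_eq_zero (n := n) (c := fun k =>
    ((n : ℝ) - k) * ∫ p, sigma k x ν p * mink (testMap R θ a x ν p) (posMap x p) ∂(areaMeasure x) -
      (k + 1) * ∫ p, sigma (k + 1) x ν p * mink (testMap R θ a x ν p) (norMap x ν p)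
        ∂(areaMeasure x)) (fun t => ?_) hk
  rw [← hx.integral_balance_eq_zero hR hθ₀ hθπ t a]
  simp only [hx.balance_one t a]
  rw [integral_finsetSum]
  · refine Finset.sum_congr rfl fun k hk => ?_
    have hk' := Finset.mem_range.mp hk
    rw [integral_const_mul, integral_sub ((hα k hk'.le).const_mul _)
      ((hβ (k + 1) hk').const_mul _), integral_const_mul, integral_const_mul]
  · intro k hk
    have hk' := Finset.mem_range.mp hk
    exact (((hα k hk'.le).const_mul _).sub ((hβ (k + 1) hk').const_mul _)).const_mul _

end IsCapillaryImmersion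

end Capillary

end HypBall

theorem proposition2p1 {n : ℕ} [NeZero n] {M : Type*} [TopologicalSpace M] [T2Space M]
    [CompactSpace M] [ChartedSpace (EuclideanHalfSpace n) M] [IsManifold (𝓡∂ n) ∞ M]
    [MeasurableSpace M] [BorelSpace M]
    (R : ℝ) (hR : 0 < R) (θ : ℝ) (hθ₀ : 0 < θ) (hθπ : θ < Real.pi)
    (a : HypBall.Euc (n + 1)) (ha : ‖a‖ = 1)
    (x ν : M → HypBall.Euc (n + 1)) (hx : HypBall.IsCapillaryImmersion R θ x ν)
    (k : ℕ) (hk₁ : 1 ≤ k) (hkn : k ≤ n) :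
    ((n : ℝ) - (k : ℝ) + 1) *
        ∫ p, (HypBall.sigma (k - 1) x ν p * HypBall.funV a (x p) +
          Real.sinh R * Real.cos θ * HypBall.sigma (k - 1) x ν p *
            HypBall.hypMetric (x p) (HypBall.fieldY a (x p)) (ν p))
          ∂(HypBall.areaMeasure x) =
      (k : ℝ) *
        ∫ p, HypBall.sigma k x ν p *
            HypBall.hypMetric (x p) (HypBall.fieldX R a (x p)) (ν p)
          ∂(HypBall.areaMeasure x) := by
  -- The formula indexed by `σ_{k-1}` and `σ_k` becomes `integral_sigma`, which is indexed from
  -- zero.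
  obtain ⟨k, rfl⟩ := Nat.exists_eq_add_of_le' hk₁
  have h := hx.integral_sigma hR hθ₀ hθπ a (Nat.lt_of_succ_le hkn)
  simp only [hx.mink_testMap_posMap, hx.mink_testMap_norMap] at h
  rw [Nat.add_sub_cancel, Nat.cast_succ, sub_add_eq_sub_sub, sub_add_cancel, ← h]
  congr 2
  funext p
  ring
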